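/- Let $n\ge 1$ and let $H\to\mathbb P^n$ be the hyperplane bundle, with homogeneous coordinates $[Z_0:\dots:Z_n]$. Let $\mathcal H_H$ be the space of Kähler potentials of $H$, i.e. of smooth Hermitian metrics $e^{-\varphi}$ on $H$ with $\sqrt{-1}\,\partial\bar\partial\varphi>0$. A smooth curve $t\mapsto\varphi(t,\cdot)\in\mathcal H_H$, $a\le t\le b$, is a geodesic if $(\sqrt{-1}\,\partial\bar\partial\Phi)^{n+1}=0$ on $\{a<\mathrm{Re}\,s<b\}\times\mathbb P^n$, where $\Phi(s,z)=\varphi(\mathrm{Re}\,s,z)$. Use the flag $Y_i=\{Z_0=\dots=Z_{i-1}=0\}$, $0\le i\le n$, and on $\{Z_n\ne0\}$ the coordinates $z_i=Z_i/Z_n$ $(0\le i<n)$ and the standard trivialization of $H$, so that sections of $mH$ become polynomials of degree at most $m$ in $z_0,\dots,z_{n-1}$. For such a section $s\ne0$ let $\nu(s)\in\mathbb N^n$ be the lexicographically smallest exponent that occurs in $s$; put $\Delta_m=\{\nu(s): 0\ne s\in H^0(\mathbb P^n,mH)\}$ and let $\Delta=\overline{\bigcup_{m\ge1}\tfrac1m\Delta_m}\subset\mathbb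 R^n$ be the Okounkov body. Given $\varphi\in\mathcal H_H$ and a smooth volume form $\mu$ on $\mathbb P^n$, for $a\in\Delta_m$ let $Ch_{m,a/m}$ be the section of $mH$ of minimal norm, $\|s\|^2_{m\varphi,\mu}=\int|s|^2e^{-m\varphi}d\mu$, among those with leading term $z^a$, that is, with $\nu(s)=a$ and coefficient of $z^a$ equal to $1$. The Chebyshev potential of $\varphi$ at $\alpha\in\mathrm{Int}\,\Delta$ is $$c[\varphi](\alpha)=\lim_{k\to\infty}\frac1{m_k}\log\|Ch_{m_k,\alpha_k}\|^2_{m_k\varphi,\mu},$$ where $m_k\geq 1$ is strictly increasing and $\alpha_k\in\frac1{m_k}\Delta_{m_k}$ converges to $\alpha$; the value does not depend on the choice of $m_k$, $\alpha_k$ and $\mu$. (1) For every $n\ge1$ there is a geodesic $t\mapsto\varphi(t,\cdot)\in\mathcal H_H$, $0\le t\le1$, whose Chebyshev potentials $c[\varphi(t,\cdot)]$ exist (the limits exist and are independent of the choices) and for which $t\mapsto c[\varphi(t,\cdot)]$ is not affine in $t$. In particular the folklore conjecture, that a smooth segment $t\mapsto\varphi(t,\cdot)$ of Kähler potentials is a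 geodesic if and only if $t\mapsto c[\varphi(t,\cdot)]$ is affine, fails for $H\to\mathbb P^n$. (2) Explicitly, let $n=1$ and $$P(t)=\begin{pmatrix}\cosh t&\sinh t\\ \sinh t&\cosh t\end{pmatrix},\qquad \varphi_{P(t)}=\log\big(\bar z^{\mathsf T}P(t)z\big),\quad z=(z_0,1)^{\mathsf T}.$$ For every $t\in\mathbb R$ the matrix $P(t)$ is positive definite, and with $\mu_i(P)=\det_i(P)/\det_{i+1}(P)$, where $\det_i(P)$ is the determinant of the submatrix of $P$ of the entries with both indices $\ge i$ (indices starting at $0$; $\det_2(P)=1$), one has $\mu_0(P(t))=1/\cosh t$ and $\mu_1(P(t))=\cosh t$. On every interval $[a,b]$, $a<b$, the curve $t\mapsto\varphi_{P(t)}$ is a geodesic in $\mathcal H_H$, its Chebyshev potentials exist, and $t\mapsto c[\varphi_{P(t)}]$ is not affine on $[a,b]$. -/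

import Mathlib

open scoped ComplexOrder ContDiff Topology

noncomputable section

namespace ChebyshevFS

/-! ### Projective space and the hyperplane bundle

Points of `ℙⁿ` are given by homogeneous coordinates `Z = (Z₀, …, Zₙ) ≠ 0`.  Away from its zero
section, the dual `H⁻¹` of the hyperplane bundle `H` is `ℂⁿ⁺¹ ∖ {0}`.  Hence:

* a Hermitian metric `e^{-φ}` on `H` is a function `φ : ℂⁿ⁺¹ ∖ {0} → ℝ` with
  `φ (lZ) = φ Z + log |l|²`; its local potential on `{Zᵢ ≠ 0}` is the restriction of `φ` to
  `{Zᵢ = 1}`.  (The value at `Z = 0` is irrelevant.)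
* the holomorphic sections of `mH` are the homogeneous polynomials of degree `m` in `Z`. -/

/-- The inverse of the `i`-th standard affine chart: the homogeneous coordinate vector with `1` in
position `i` and the entries of `z` in the other positions. -/
def affinePoint {n : ℕ} (i : Fin (n + 1)) (z : Fin n → ℂ) : Fin (n + 1) → ℂ :=
  Fin.insertNth (α := fun _ => ℂ) i 1 z

/-- The Wirtinger derivative `∂f/∂zⱼ = (∂f/∂xⱼ - i ∂f/∂yⱼ) / 2`. -/
def dZ {k : ℕ} (j : Fin k) (f : (Fin k → ℂ) → ℂ) (z : Fin k → ℂ) : ℂ :=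
  (1 / 2) * (fderiv ℝ f z (Pi.single j 1) - Complex.I * fderiv ℝ f z (Pi.single j Complex.I))

/-- The Wirtinger derivative `∂f/∂z̄ⱼ = (∂f/∂xⱼ + i ∂f/∂yⱼ) / 2`. -/
def dZbar {k : ℕ} (j : Fin k) (f : (Fin k → ℂ) → ℂ) (z : Fin k → ℂ) : ℂ :=
  (1 / 2) * (fderiv ℝ f z (Pi.single j 1) + Complex.I * fderiv ℝ f z (Pi.single j Complex.I))

/-- The matrix `(∂²u/∂zⱼ∂z̄ₗ)` of the form `√-1 ∂∂̄u`. -/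
def complexHessian {k : ℕ} (u : (Fin k → ℂ) → ℝ) (z : Fin k → ℂ) : Matrix (Fin k) (Fin k) ℂ :=
  Matrix.of fun j l => dZ j (dZbar l (fun w => (u w : ℂ))) z

/-- The space of Kähler potentials of the hyperplane bundle: smooth metrics `e^{-φ}` on `H` with
positive curvature form `√-1 ∂∂̄φ`. -/
structure IsKahlerPotential {n : ℕ} (φ : (Fin (n + 1) → ℂ) → ℝ) : Prop where
  smooth : ContDiffOn ℝ ∞ φ {0}ᶜ
  homogeneous : ∀ (l : ℂ) (Z : Fin (n + 1) → ℂ), l ≠ 0 → Z ≠ 0 →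
    φ (l • Z) = φ Z + Real.log (‖l‖ ^ 2)
  positive : ∀ (i : Fin (n + 1)) (z : Fin n → ℂ),
    (complexHessian (fun w => φ (affinePoint i w)) z).PosDef

/-- A smooth curve `t ↦ φ t`, `a ≤ t ≤ b`, in the space of Kähler potentials. -/
structure IsKahlerSegment {n : ℕ} (a b : ℝ) (φ : ℝ → (Fin (n + 1) → ℂ) → ℝ) : Prop where
  smooth : ContDiffOn ℝ ∞ (fun p : ℝ × (Fin (n + 1) → ℂ) => φ p.1 p.2) (Set.Icc a b ×ˢ {0}ᶜ)
  kahler : ∀ t ∈ Set.Icc a b, IsKahlerPotential (φ t)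

/-- A geodesic segment: on the product of the strip `{a < Re s < b}` with each affine chart, the
function `(s, z) ↦ φ (Re s) z` solves the homogeneous complex Monge–Ampère equation
`(√-1 ∂∂̄φ)ⁿ⁺¹ = 0`.  The variable `s` is `w 0`, and `z` is the tail of `w`. -/
structure IsGeodesic {n : ℕ} (a b : ℝ) (φ : ℝ → (Fin (n + 1) → ℂ) → ℝ) : Prop
    extends IsKahlerSegment a b φ where
  monge_ampere : ∀ (i : Fin (n + 1)) (w : Fin (n + 1) → ℂ), (w 0).re ∈ Set.Ioo a b →
    (complexHessian
      (fun v : Fin (n + 1) → ℂ => φ (v 0).re (affinePoint i (Fin.tail v))) w).det = 0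

/-! ### Okounkov body

The flag is `Yᵢ = {Z₀ = ⋯ = Zᵢ₋₁ = 0}`, with `Yₙ = {p}`, `p = [0 : ⋯ : 0 : 1]`; the coordinates
`zᵢ = Zᵢ / Zₙ` on `{Zₙ ≠ 0}` are centred at `p` and adapted to the flag. -/

/-- The expression of a section in the coordinates and the trivialization over `{Zₙ ≠ 0}`,
obtained by setting `Zₙ = 1`. -/
def localExpr {n : ℕ} (s : MvPolynomial (Fin (n + 1)) ℂ) : MvPolynomial (Fin n) ℂ :=
  MvPolynomial.aeval
    (Fin.insertNth (α := fun _ => MvPolynomial (Fin n) ℂ) (Fin.last n) 1 MvPolynomial.X) s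

/-- `ν(s) = a`: the lexicographically smallest exponent in the expansion `s = ∑ kₐ zᵃ` is `a`. -/
def HasOrder {n : ℕ} (s : MvPolynomial (Fin (n + 1)) ℂ) (a : Fin n →₀ ℕ) : Prop :=
  (localExpr s).coeff a ≠ 0 ∧ ∀ b, (localExpr s).coeff b ≠ 0 → toLex a ≤ toLex b

/-- `Δₘ(H) = {ν(s) | s ∈ H⁰(ℙⁿ, mH) ∖ {0}}`. -/
def orderSet (n m : ℕ) : Set (Fin n →₀ ℕ) :=
  {a | ∃ s ∈ MvPolynomial.homogeneousSubmodule (Fin (n + 1)) ℂ m, HasOrder s a}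

/-- The Okounkov body, the closure of `⋃ₘ (1/m) Δₘ(H)`. -/
def okounkovBody (n : ℕ) : Set (Fin n → ℝ) :=
  closure {x | ∃ m : ℕ, 0 < m ∧ ∃ a ∈ orderSet n m, x = fun i => (a i : ℝ) / m}

/-! ### Chebyshev potential -/

/-- A smooth volume form on `ℙⁿ`, given by a smooth positive function `ρ` on `ℂⁿ⁺¹ ∖ {0}` that is
homogeneous of degree `-2(n+1)`: in each affine chart `{Zᵢ = 1}` the volume form is the restriction
of `ρ` times Lebesgue measure. -/
structure IsVolumeForm {n : ℕ} (ρ : (Fin (n + 1) → ℂ) → ℝ) : Prop where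
  smooth : ContDiffOn ℝ ∞ ρ {0}ᶜ
  pos : ∀ Z, Z ≠ 0 → 0 < ρ Z
  homogeneous : ∀ (l : ℂ) (Z : Fin (n + 1) → ℂ), l ≠ 0 → Z ≠ 0 →
    ρ (l • Z) = ρ Z / ‖l‖ ^ (2 * (n + 1))

/-- `‖s‖² = ∫ |s|² e^{-mφ} dμ` for a section `s` of `mH` and the volume form `μ` given by `ρ`.
The complement of the chart `{Zₙ ≠ 0}` has measure zero. -/
def hilbNormSq {n : ℕ} (φ ρ : (Fin (n + 1) → ℂ) → ℝ) (m : ℕ)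
    (s : MvPolynomial (Fin (n + 1)) ℂ) : ℝ :=
  ∫ z : Fin n → ℂ, ‖MvPolynomial.eval (affinePoint (Fin.last n) z) s‖ ^ 2 *
    Real.exp (-(m * φ (affinePoint (Fin.last n) z))) * ρ (affinePoint (Fin.last n) z)

/-- The affine space of the sections of `mH` with leading term `zᵃ`. -/
def monicSections (n m : ℕ) (a : Fin n →₀ ℕ) : Set (MvPolynomial (Fin (n + 1)) ℂ) :=
  {s | s ∈ MvPolynomial.homogeneousSubmodule (Fin (n + 1)) ℂ m ∧ HasOrder s a ∧
    (localExpr s).coeff a = 1}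

/-- `s` is a Chebyshev section: it minimizes the norm among the sections with leading term `zᵃ`. -/
def IsChebyshevSection {n : ℕ} (φ ρ : (Fin (n + 1) → ℂ) → ℝ) (m : ℕ) (a : Fin n →₀ ℕ)
    (s : MvPolynomial (Fin (n + 1)) ℂ) : Prop :=
  s ∈ monicSections n m a ∧ ∀ s' ∈ monicSections n m a, hilbNormSq φ ρ m s ≤ hilbNormSq φ ρ m s'

/-- `c` is the limit of `(1/mₖ) log ‖Chₖ‖²` for every smooth volume form, every strictly increasing
sequence `mₖ` of positive integers and all points `aₖ/mₖ` of `(1/mₖ) Δ_{mₖ}(H)` that converge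
to `α`, where `Chₖ` is the Chebyshev section of `mₖH` with leading exponent `aₖ`. -/
def IsChebyshevLimit {n : ℕ} (φ : (Fin (n + 1) → ℂ) → ℝ) (α : Fin n → ℝ) (c : ℝ) : Prop :=
  ∀ ρ : (Fin (n + 1) → ℂ) → ℝ, IsVolumeForm ρ →
  ∀ m : ℕ → ℕ, StrictMono m → (∀ k, 0 < m k) →
  ∀ a : ℕ → (Fin n →₀ ℕ), (∀ k, a k ∈ orderSet n (m k)) →
  Filter.Tendsto (fun k => (fun i => (a k i : ℝ) / m k : Fin n → ℝ)) Filter.atTop (𝓝 α) →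
  ∀ s : ℕ → MvPolynomial (Fin (n + 1)) ℂ,
  (∀ k, IsChebyshevSection φ ρ (m k) (a k) (s k)) →
  Filter.Tendsto (fun k => 1 / (m k : ℝ) * Real.log (hilbNormSq φ ρ (m k) (s k)))
    Filter.atTop (𝓝 c)

open Classical in
/-- The Chebyshev potential `c[φ]`, considered on the interior of the Okounkov body. -/
def chebyshevPotential {n : ℕ} (φ : (Fin (n + 1) → ℂ) → ℝ) (α : Fin n → ℝ) : ℝ :=
  if h : ∃ c, IsChebyshevLimit φ α c then h.choose else 0

/-- The curve `t ↦ c[φ t]`, `a ≤ t ≤ b`, of functions on the interior of the Okounkov body is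
affine in `t`. -/
def ChebyshevAffine {n : ℕ} (a b : ℝ) (φ : ℝ → (Fin (n + 1) → ℂ) → ℝ) : Prop :=
  ∀ α ∈ interior (okounkovBody n), ∃ A B : ℝ, ∀ t ∈ Set.Icc a b,
    chebyshevPotential (φ t) α = A + t * B

/-- The limits that define `c[φ t]`, `a ≤ t ≤ b`, exist on the interior of the Okounkov body. -/
def ChebyshevExists {n : ℕ} (a b : ℝ) (φ : ℝ → (Fin (n + 1) → ℂ) → ℝ) : Prop :=
  ∀ t ∈ Set.Icc a b, ∀ α ∈ interior (okounkovBody n),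
    IsChebyshevLimit (φ t) α (chebyshevPotential (φ t) α)

/-! ### Fubini–Study potentials -/

/-- The Fubini–Study potential `φ_P = log (Zᴴ P Z)`. -/
def fubiniStudy {n : ℕ} (P : Matrix (Fin (n + 1)) (Fin (n + 1)) ℂ) (Z : Fin (n + 1) → ℂ) : ℝ :=
  Real.log (star Z ⬝ᵥ P.mulVec Z).re

/-- `det_i(P)`, the determinant of the submatrix of the entries `p_{jl}` with `j, l ≥ i`; it is `1`
for `i > n`. -/
def tailDet {n : ℕ} (P : Matrix (Fin (n + 1)) (Fin (n + 1)) ℂ) (i : ℕ) : ℂ :=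
  (P.submatrix (Subtype.val : {j : Fin (n + 1) // i ≤ (j : ℕ)} → Fin (n + 1))
    (Subtype.val : {j : Fin (n + 1) // i ≤ (j : ℕ)} → Fin (n + 1))).det

/-- `μ_i(P) = det_i(P) / det_{i+1}(P)`. -/
def mu {n : ℕ} (i : ℕ) (P : Matrix (Fin (n + 1)) (Fin (n + 1)) ℂ) : ℂ :=
  tailDet P i / tailDet P (i + 1)

/-- The curve of `2 × 2` matrices with rows `(cosh t, sinh t)` and `(sinh t, cosh t)`. -/
def coshCurve (t : ℝ) : Matrix (Fin (1 + 1)) (Fin (1 + 1)) ℂ :=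
  !![(Real.cosh t : ℂ), (Real.sinh t : ℂ); (Real.sinh t : ℂ), (Real.cosh t : ℂ)]

end ChebyshevFS

end

/-!
Let `A` be the Hermitian matrix on `ℂⁿ⁺¹` that exchanges the first and the last coordinate and
annihilates the others. The curve is `φ_t = log (Zᴴ exp (t A) Z) = log ‖exp (t A / 2) Z‖²`; for
`n = 1` it is the curve of Fubini–Study potentials of the matrices `coshCurve t`.

It is a geodesic because `(s, Z) ↦ exp (s A / 2) Z` is holomorphic, so that `√-1 ∂∂̄Φ` is the
pull-back of the Fubini–Study form on `ℙⁿ` under a map from a space of dimension `n + 1`.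
Concretely, the complex Hessian of `log ‖f‖²` for holomorphic `f` is the Gram form of the
derivative of `f` modulo `f` (`complexHessian_log_normSq`). It is positive where the derivative is
injective modulo `f`, and it degenerates in a direction in which the derivative of `f` is a
multiple of `f` (`isGeodesic_flowPotential`).

To find the Chebyshev potentials, complete the square: `‖exp (t A / 2) Z‖² = ∑ⱼ μⱼ |(L Z)ⱼ|²`,
where `L` adds `tanh t · Z₀` to `Zₙ` and `μ = (1 / cosh t, 1, …, 1, cosh t)`
(`norm_flowFrame_sq_eq_sum_pivot`). The map `L` preserves the flag, hence leading terms
(`coeff_shearPoly_of_mem_monicSections`). For the volume form `‖exp (t A / 2) Z‖^(-2(n+1))` the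
norm of a section is, up to a constant that depends on the degree only, its norm on `ℂⁿ⁺¹` for the
Gaussian weight `exp (-‖exp (t A / 2) Z‖²)` (`integral_eval_affinePoint`). Monomials in `L Z` are
orthogonal for this weight, so they are the Chebyshev sections (`isChebyshevSection_flowSection`),
and their norms are products of factorials. Any other volume form changes the norms by bounded
factors (`exists_hilbNormSq_bounds`), which do not matter in the limit. Stirling's formula gives
`c[φ_t](α) = ∑ⱼ (αⱼ log αⱼ - αⱼ log μⱼ)` in barycentric coordinates
(`isChebyshevLimit_flowPotential`), that is, a function of `α` plus `(α₀ - αₙ) log (cosh t)`. As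
`log ∘ cosh` is not affine on any interval, neither is the curve of Chebyshev potentials at a
point with `α₀ ≠ αₙ`. -/

open scoped ComplexOrder ContDiff Topology

noncomputable section

namespace ChebyshevFS

/-! ### The complex Hessian of `log ‖f‖²` -/

section Hessian

variable {k : ℕ} {V : Type*} [NormedAddCommGroup V] [InnerProductSpace ℂ V]

theorem single_I (j : Fin k) :
    (Pi.single j Complex.I : Fin k → ℂ) = Complex.I • Pi.single j 1 := by
  rw [← Pi.single_smul]; simp

theorem HasFDerivAt.dZ_eq {f : (Fin k → ℂ) → ℂ} {L : (Fin k → ℂ) →L[ℝ] ℂ} {z : Fin k → ℂ}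
    (h : HasFDerivAt f L z) (j : Fin k) :
    dZ j f z = (1 / 2) * (L (Pi.single j 1) - Complex.I * L (Complex.I • Pi.single j 1)) := by
  rw [dZ, h.fderiv, single_I]

theorem HasFDerivAt.dZbar_eq {f : (Fin k → ℂ) → ℂ} {L : (Fin k → ℂ) →L[ℝ] ℂ} {z : Fin k → ℂ}
    (h : HasFDerivAt f L z) (j : Fin k) :
    dZbar j f z = (1 / 2) * (L (Pi.single j 1) + Complex.I * L (Complex.I • Pi.single j 1)) := by
  rw [dZbar, h.fderiv, single_I]

theorem hasFDerivAt_inner_real {f g : (Fin k → ℂ) → V} {f' g' : (Fin k → ℂ) →L[ℂ] V}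
    {z : Fin k → ℂ} (hf : HasFDerivAt f f' z) (hg : HasFDerivAt g g' z) :
    HasFDerivAt (fun w => inner ℂ (g w) (f w))
      ((fderivInnerCLM ℂ (g z, f z)).comp
        ((g'.restrictScalars ℝ).prod (f'.restrictScalars ℝ))) z :=
  (hg.restrictScalars ℝ).inner ℂ (hf.restrictScalars ℝ)

/-- For holomorphic `f` and `g` the function `⟪g, f⟫` is antiholomorphic in `g`, so the derivative
`∂/∂zⱼ` falls on `f` only. -/
theorem dZ_inner {f g : (Fin k → ℂ) → V} {f' g' : (Fin k → ℂ) →L[ℂ] V}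
    {z : Fin k → ℂ} (hf : HasFDerivAt f f' z) (hg : HasFDerivAt g g' z) (j : Fin k) :
    dZ j (fun w => inner ℂ (g w) (f w)) z = inner ℂ (g z) (f' (Pi.single j 1)) := by
  rw [HasFDerivAt.dZ_eq (hasFDerivAt_inner_real hf hg)]
  simp only [ContinuousLinearMap.comp_apply, ContinuousLinearMap.prod_apply,
    ContinuousLinearMap.coe_restrictScalars', fderivInnerCLM_apply, map_smul, inner_smul_left,
    inner_smul_right, Complex.conj_I]
  linear_combination (1 / 2 * inner ℂ (g' (Pi.single j 1)) (f z) -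
    1 / 2 * inner ℂ (g z) (f' (Pi.single j 1))) * Complex.I_sq

theorem dZbar_inner {f g : (Fin k → ℂ) → V} {f' g' : (Fin k → ℂ) →L[ℂ] V}
    {z : Fin k → ℂ} (hf : HasFDerivAt f f' z) (hg : HasFDerivAt g g' z) (j : Fin k) :
    dZbar j (fun w => inner ℂ (g w) (f w)) z = inner ℂ (g' (Pi.single j 1)) (f z) := by
  rw [HasFDerivAt.dZbar_eq (hasFDerivAt_inner_real hf hg)]
  simp only [ContinuousLinearMap.comp_apply, ContinuousLinearMap.prod_apply,
    ContinuousLinearMap.coe_restrictScalars', fderivInnerCLM_apply, map_smul, inner_smul_left,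
    inner_smul_right, Complex.conj_I]
  linear_combination (1 / 2 * inner ℂ (g z) (f' (Pi.single j 1)) -
    1 / 2 * inner ℂ (g' (Pi.single j 1)) (f z)) * Complex.I_sq

theorem dZ_div {p q : (Fin k → ℂ) → ℂ} {z : Fin k → ℂ} (hp : DifferentiableAt ℝ p z)
    (hq : DifferentiableAt ℝ q z) (h0 : q z ≠ 0) (j : Fin k) :
    dZ j (fun w => p w / q w) z = (dZ j p z * q z - p z * dZ j q z) / q z ^ 2 := by
  have hinv : HasFDerivAt (fun w => (q w)⁻¹)
      (-(q z ^ 2)⁻¹ • fderiv ℝ q z) z :=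
    (hasDerivAt_inv h0).comp_hasFDerivAt_of_eq z (hq.hasFDerivAt) rfl
  have h := hp.hasFDerivAt.fun_mul hinv
  simp only [div_eq_mul_inv]
  rw [HasFDerivAt.dZ_eq h, HasFDerivAt.dZ_eq hp.hasFDerivAt, HasFDerivAt.dZ_eq hq.hasFDerivAt]
  simp
  field_simp
  ring

theorem dZbar_log_normSq {f : (Fin k → ℂ) → V} {f' : (Fin k → ℂ) →L[ℂ] V} {z : Fin k → ℂ}
    (hf : HasFDerivAt f f' z) (h0 : f z ≠ 0) (l : Fin k) :
    dZbar l (fun w => (Real.log (‖f w‖ ^ 2) : ℂ)) z =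
      inner ℂ (f' (Pi.single l 1)) (f z) / inner ℂ (f z) (f z) := by
  have hinner := hasFDerivAt_inner_real hf hf
  have hreal : HasFDerivAt (fun w => ‖f w‖ ^ 2)
      (Complex.reCLM.comp ((fderivInnerCLM ℂ (f z, f z)).comp
        ((f'.restrictScalars ℝ).prod (f'.restrictScalars ℝ)))) z := by
    have := Complex.reCLM.hasFDerivAt.comp z hinner
    refine this.congr_of_eventuallyEq (Filter.Eventually.of_forall fun w => ?_)
    simp [inner_self_eq_norm_sq_to_K, ← Complex.ofReal_pow]
  have hpos : ‖f z‖ ^ 2 ≠ 0 := by simpa using h0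
  have hlog := Complex.ofRealCLM.hasFDerivAt.comp z (hreal.log hpos)
  have e := HasFDerivAt.dZbar_eq hlog l
  refine e.trans ?_
  rw [← dZbar_inner hf hf l, HasFDerivAt.dZbar_eq hinner]
  simp only [one_div, map_smul, ContinuousLinearMap.comp_apply, ContinuousLinearMap.prod_apply,
    smul_apply, ContinuousLinearMap.coe_restrictScalars',
    fderivInnerCLM_apply, inner_smul_left, inner_smul_right, Complex.conj_I, smul_eq_mul,
    Complex.ofRealCLM_apply, Complex.reCLM_apply, inner_self_eq_norm_sq_to_K]
  rw [← inner_conj_symm (f z) (f' (Pi.single l 1))]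
  generalize inner ℂ (f' (Pi.single l 1)) (f z) = c
  apply Complex.ext <;> simp [← Complex.ofReal_pow] <;> ring

/-- The complex Hessian of `log ‖f‖²` for a holomorphic `f` without zeros: the pull-back of the
Fubini–Study form. -/
theorem complexHessian_log_normSq {f : (Fin k → ℂ) → V} (hf : ContDiff ℂ 2 f)
    (h0 : ∀ z, f z ≠ 0) (z : Fin k → ℂ) (j l : Fin k) :
    complexHessian (fun w => Real.log (‖f w‖ ^ 2)) z j l =
      (inner ℂ (fderiv ℂ f z (Pi.single l 1)) (fderiv ℂ f z (Pi.single j 1)) * inner ℂ (f z) (f z) -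
        inner ℂ (fderiv ℂ f z (Pi.single l 1)) (f z) * inner ℂ (f z) (fderiv ℂ f z (Pi.single j 1)))
        / inner ℂ (f z) (f z) ^ 2 := by
  have hd : ∀ w, HasFDerivAt f (fderiv ℂ f w) w := fun w =>
    (hf.differentiable (by norm_num) w).hasFDerivAt
  have hg : HasFDerivAt (fun w => fderiv ℂ f w (Pi.single l 1))
      (fderiv ℂ (fun w => fderiv ℂ f w (Pi.single l 1)) z) z := by
    refine DifferentiableAt.hasFDerivAt ?_
    have : Differentiable ℂ (fderiv ℂ f) :=
      (hf.fderiv_right (m := 1) (by norm_num)).differentiable (by norm_num)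
    exact (this z).clm_apply (differentiableAt_const _)
  have h1 : (dZbar l fun w => (Real.log (‖f w‖ ^ 2) : ℂ)) =
      fun w => inner ℂ (fderiv ℂ f w (Pi.single l 1)) (f w) / inner ℂ (f w) (f w) :=
    funext fun w => dZbar_log_normSq (hd w) (h0 w) l
  rw [complexHessian, Matrix.of_apply, h1,
    dZ_div (hasFDerivAt_inner_real (hd z) hg).differentiableAt
      (hasFDerivAt_inner_real (hd z) (hd z)).differentiableAt (inner_self_ne_zero.2 (h0 z)),
    dZ_inner (hd z) hg, dZ_inner (hd z) (hd z)]

theorem complexHessian_mulVec_log_normSq {f : (Fin k → ℂ) → V} (hf : ContDiff ℂ 2 f)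
    (h0 : ∀ z, f z ≠ 0) (z x : Fin k → ℂ) (j : Fin k) :
    ((complexHessian (fun w => Real.log (‖f w‖ ^ 2)) z).mulVec x) j =
      (inner ℂ (fderiv ℂ f z (star x)) (fderiv ℂ f z (Pi.single j 1)) * inner ℂ (f z) (f z) -
        inner ℂ (fderiv ℂ f z (star x)) (f z) * inner ℂ (f z) (fderiv ℂ f z (Pi.single j 1)))
        / inner ℂ (f z) (f z) ^ 2 := by
  have hx : fderiv ℂ f z (star x) =
      ∑ l, starRingEnd ℂ (x l) • fderiv ℂ f z (Pi.single l 1) := by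
    conv_lhs => rw [← Finset.univ_sum_single (star x)]
    rw [map_sum]
    refine Finset.sum_congr rfl fun l _ => ?_
    rw [← map_smul, ← Pi.single_smul]; simp
  simp only [Matrix.mulVec, dotProduct, complexHessian_log_normSq hf h0, hx, sum_inner,
    inner_smul_left, Complex.conj_conj]
  rw [Finset.sum_mul, Finset.sum_mul, ← Finset.sum_sub_distrib, Finset.sum_div]
  exact Finset.sum_congr rfl fun l _ => by ring

/-- If the derivative of `f` in some direction is a multiple of `f`, the map `[f]` to projective
space is not immersive, and the pulled back Fubini–Study form degenerates. -/
theorem complexHessian_log_normSq_det_eq_zero {f : (Fin k → ℂ) → V} (hf : ContDiff ℂ 2 f)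
    (h0 : ∀ z, f z ≠ 0) {z v : Fin k → ℂ} (hv : v ≠ 0) {c : ℂ} (hc : fderiv ℂ f z v = c • f z) :
    (complexHessian (fun w => Real.log (‖f w‖ ^ 2)) z).det = 0 := by
  refine Matrix.exists_mulVec_eq_zero_iff.1 ⟨star v, by simpa using hv, ?_⟩
  funext j
  rw [complexHessian_mulVec_log_normSq hf h0, star_star, hc]
  simp only [inner_smul_left, Pi.zero_apply]
  ring

/-- Where `[f]` is an immersion into projective space, the pulled back Fubini–Study form is
positive: this is the strict Cauchy–Schwarz inequality. -/
theorem complexHessian_log_normSq_posDef {f : (Fin k → ℂ) → V} (hf : ContDiff ℂ 2 f)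
    (h0 : ∀ z, f z ≠ 0) (z : Fin k → ℂ)
    (hind : ∀ v ≠ 0, ∀ c : ℂ, fderiv ℂ f z v ≠ c • f z) :
    (complexHessian (fun w => Real.log (‖f w‖ ^ 2)) z).PosDef := by
  refine Matrix.PosDef.of_dotProduct_mulVec_pos ?_ fun x hx => ?_
  · ext j l
    simp only [Matrix.conjTranspose_apply, complexHessian_log_normSq hf h0, RCLike.star_def,
      map_div₀, map_sub, map_mul, map_pow, inner_conj_symm]
    ring
  · set F := fderiv ℂ f z (star x) with hF
    have key : star x ⬝ᵥ (complexHessian (fun w => Real.log (‖f w‖ ^ 2)) z).mulVec x =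
        (((‖F‖ ^ 2 * ‖f z‖ ^ 2 - ‖inner ℂ (f z) F‖ ^ 2) / (‖f z‖ ^ 2) ^ 2 : ℝ) : ℂ) := by
      have e : (star x ⬝ᵥ (complexHessian (fun w => Real.log (‖f w‖ ^ 2)) z).mulVec x) =
          (inner ℂ F F * inner ℂ (f z) (f z) - inner ℂ F (f z) * inner ℂ (f z) F)
            / inner ℂ (f z) (f z) ^ 2 := by
        have hx : F = ∑ l, star (x l) • fderiv ℂ f z (Pi.single l 1) := by
          rw [hF]
          conv_lhs => rw [← Finset.univ_sum_single (star x)]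
          rw [map_sum]
          refine Finset.sum_congr rfl fun l _ => ?_
          rw [← map_smul, ← Pi.single_smul]; simp
        have hr : ∀ y : V, inner ℂ y F =
            ∑ l, star (x l) * inner ℂ y (fderiv ℂ f z (Pi.single l 1)) := fun y => by
          rw [hx, inner_sum]; simp only [inner_smul_right]
        simp only [dotProduct, complexHessian_mulVec_log_normSq hf h0, ← hF]
        rw [hr F, hr (f z), Finset.sum_mul, Finset.mul_sum, ← Finset.sum_sub_distrib,
          Finset.sum_div]
        exact Finset.sum_congr rfl fun l _ => by simp only [Pi.star_apply]; ring
      rw [e, ← inner_conj_symm F (f z), inner_self_eq_norm_sq_to_K, inner_self_eq_norm_sq_to_K,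
        Complex.conj_mul']
      push_cast
      rfl
    rw [key]
    have h1 : ‖inner ℂ (f z) F‖ < ‖f z‖ * ‖F‖ := by
      refine lt_of_le_of_ne (norm_inner_le_norm _ _) fun h => ?_
      have h' : f z = 0 ∨ ∃ r : ℂ, F = r • f z :=
        ((norm_inner_eq_norm_tfae ℂ (f z) F).out 0 2).1 h
      obtain ⟨c, hc⟩ := h'.resolve_left (h0 z)
      exact hind (star x) (by simpa using hx) c hc
    have h2 : 0 < ‖f z‖ := norm_pos_iff.2 (h0 z)
    have h3 : ‖inner ℂ (f z) F‖ ^ 2 < (‖f z‖ * ‖F‖) ^ 2 := by gcongr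
    have : (0 : ℝ) < (‖F‖ ^ 2 * ‖f z‖ ^ 2 - ‖inner ℂ (f z) F‖ ^ 2) / (‖f z‖ ^ 2) ^ 2 := by
      apply div_pos _ (by positivity)
      nlinarith
    exact_mod_cast this

end Hessian

/-! ### The geodesic -/

section Flow

variable {k : ℕ}

theorem castSucc_succ_ne_last (i : Fin k) : i.castSucc.succ ≠ Fin.last (k + 1) := by
  rw [← Fin.succ_last, Ne, Fin.succ_inj]
  exact i.castSucc_ne_last

/-- The action of the complexified one-parameter group `exp (s A / 2)` on `ℂⁿ⁺¹`, `n = k + 1`,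
where `A` exchanges the first and the last coordinate and annihilates the others; it is written in
an orthonormal basis of eigenvectors of `A`, with eigenvalues `1`, `-1` and `0`. -/
def flowFrame (k : ℕ) (s : ℂ) (Z : Fin (k + 2) → ℂ) : EuclideanSpace ℂ (Fin (k + 2)) :=
  WithLp.toLp 2 fun j =>
    if j = 0 then Complex.exp (s / 2) * (Z 0 + Z (Fin.last (k + 1))) / √2
    else if j = Fin.last (k + 1) then Complex.exp (-(s / 2)) * (Z 0 - Z (Fin.last (k + 1))) / √2
    else Z j

/-- The geodesic `t ↦ log (Zᴴ exp (t A) Z)` of Fubini–Study potentials. -/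
def flowPotential (k : ℕ) (t : ℝ) (Z : Fin (k + 2) → ℂ) : ℝ :=
  Real.log (‖flowFrame k t Z‖ ^ 2)

theorem norm_flowFrame_sq (s : ℂ) (Z : Fin (k + 2) → ℂ) :
    ‖flowFrame k s Z‖ ^ 2 = Real.exp s.re * ‖Z 0 + Z (Fin.last (k + 1))‖ ^ 2 / 2 +
      (∑ i : Fin k, ‖Z i.castSucc.succ‖ ^ 2 +
        Real.exp (-s.re) * ‖Z 0 - Z (Fin.last (k + 1))‖ ^ 2 / 2) := by
  rw [EuclideanSpace.norm_sq_eq, Fin.sum_univ_succ, Fin.sum_univ_castSucc]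
  have h2 : √2 ^ 2 = (2 : ℝ) := Real.sq_sqrt (by norm_num)
  have h4 : (Fin.last k).succ = Fin.last (k + 1) := rfl
  have h5 : Fin.last (k + 1) ≠ 0 := (Fin.last_pos).ne'
  have e1 : ∀ x : ℝ, Real.exp (x / 2) ^ 2 = Real.exp x := fun x => by
    rw [← Real.exp_nat_mul]; congr 1; push_cast; ring
  simp only [flowFrame, if_true, h4, h5, castSucc_succ_ne_last, if_false,
    Fin.succ_ne_zero, norm_div, norm_mul, Complex.norm_exp, Complex.norm_real, Real.norm_eq_abs,
    abs_of_nonneg (Real.sqrt_nonneg 2), div_pow, mul_pow, h2]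
  have e2 : (s / 2).re = s.re / 2 := by simp
  have e3 : (-(s / 2)).re = (-s.re) / 2 := by simp [neg_div]
  rw [e2, e3, e1, e1]

/-- The imaginary part of `s` acts by unitary maps. -/
theorem flowFrame_re (s : ℂ) (Z : Fin (k + 2) → ℂ) :
    ‖flowFrame k (s.re : ℂ) Z‖ ^ 2 = ‖flowFrame k s Z‖ ^ 2 := by
  simp [norm_flowFrame_sq]

theorem flowFrame_eq_zero {s : ℂ} {Z : Fin (k + 2) → ℂ} (h : flowFrame k s Z = 0) : Z = 0 := by
  have h1 := norm_flowFrame_sq s Z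
  rw [h, norm_zero] at h1
  have p1 : 0 ≤ Real.exp s.re * ‖Z 0 + Z (Fin.last (k + 1))‖ ^ 2 / 2 := by positivity
  have p2 : 0 ≤ Real.exp (-s.re) * ‖Z 0 - Z (Fin.last (k + 1))‖ ^ 2 / 2 := by positivity
  have p3 : 0 ≤ ∑ i : Fin k, ‖Z i.castSucc.succ‖ ^ 2 := by positivity
  have q1 : Real.exp s.re * ‖Z 0 + Z (Fin.last (k + 1))‖ ^ 2 / 2 = 0 := by linarith
  have q2 : Real.exp (-s.re) * ‖Z 0 - Z (Fin.last (k + 1))‖ ^ 2 / 2 = 0 := by linarith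
  have q3 : ∑ i : Fin k, ‖Z i.castSucc.succ‖ ^ 2 = 0 := by linarith
  have r1 : Z 0 + Z (Fin.last (k + 1)) = 0 := by simpa using q1
  have r2 : Z 0 - Z (Fin.last (k + 1)) = 0 := by simpa using q2
  rw [Finset.sum_eq_zero_iff_of_nonneg (fun _ _ => by positivity)] at q3
  have z0 : Z 0 = 0 := by linear_combination (r1 + r2) / 2
  funext j
  refine Fin.cases z0 (fun j => Fin.lastCases ?_ (fun i => ?_) j) j
  · change Z (Fin.last (k + 1)) = 0
    linear_combination (r1 - r2) / 2
  · simpa using q3 i (Finset.mem_univ i)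

theorem flowFrame_smul (s c : ℂ) (Z : Fin (k + 2) → ℂ) :
    flowFrame k s (c • Z) = c • flowFrame k s Z := by
  ext j
  simp only [flowFrame, PiLp.smul_apply, Pi.smul_apply, smul_eq_mul]
  split_ifs <;> ring

theorem flowFrame_sub (s : ℂ) (Z W : Fin (k + 2) → ℂ) :
    flowFrame k s (Z - W) = flowFrame k s Z - flowFrame k s W := by
  ext j
  simp only [flowFrame, PiLp.sub_apply, Pi.sub_apply]
  split_ifs <;> ring

theorem affinePoint_ne_zero {n : ℕ} (i : Fin (n + 1)) (z : Fin n → ℂ) : affinePoint i z ≠ 0 :=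
  fun h => one_ne_zero (α := ℂ) (by simpa [affinePoint] using congrFun h i)

theorem affinePoint_add {n : ℕ} (i : Fin (n + 1)) (z v : Fin n → ℂ) :
    affinePoint i (z + v) = affinePoint i z + Fin.insertNth (α := fun _ => ℂ) i 0 v := by
  funext j
  refine Fin.succAboveCases i ?_ (fun j => ?_) j <;> simp [affinePoint]

theorem contDiff_affinePoint {n : ℕ} (i : Fin (n + 1)) : ContDiff ℂ ω (affinePoint i) := by
  rw [contDiff_pi]
  intro j
  refine Fin.succAboveCases i ?_ (fun j => ?_) j
  · simpa [affinePoint] using contDiff_const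
  · simpa [affinePoint] using contDiff_apply ℂ ℂ j

theorem contDiff_flowFrame {E : Type*} [NormedAddCommGroup E] [NormedSpace ℂ E] {m : WithTop ℕ∞}
    {s : E → ℂ} {Z : E → Fin (k + 2) → ℂ} (hs : ContDiff ℂ m s) (hZ : ContDiff ℂ m Z) :
    ContDiff ℂ m fun x => flowFrame k (s x) (Z x) := by
  have hZj : ∀ j, ContDiff ℂ m fun x => Z x j := fun j => (contDiff_pi.1 hZ) j
  rw [contDiff_euclidean]
  intro j
  simp only [flowFrame]
  split_ifs
  · exact ((hs.div_const _).cexp.mul ((hZj _).add (hZj _))).div_const _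
  · exact ((hs.div_const _).neg.cexp.mul ((hZj _).sub (hZj _))).div_const _
  · exact hZj j

/-- The linear vector field `A`, which exchanges the first and the last homogeneous coordinate
and annihilates the others. -/
def swapField (Z : Fin (k + 2) → ℂ) (j : Fin (k + 2)) : ℂ :=
  if j = 0 then Z (Fin.last (k + 1)) else if j = Fin.last (k + 1) then Z 0 else 0

/-- The derivative of `exp (s A / 2) Z` in the direction `(σ, W)` is
`exp (s A / 2) (W + σ A Z / 2)`. -/
theorem hasDerivAt_flowFrame (s σ : ℂ) (Z W : Fin (k + 2) → ℂ) :
    HasDerivAt (fun τ : ℂ => flowFrame k (s + τ * σ) (Z + τ • W))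
      (flowFrame k s (W + (σ / 2) • swapField Z)) 0 := by
  have h5 : Fin.last (k + 1) ≠ 0 := (Fin.last_pos).ne'
  rw [hasDerivAt_iff_hasFDerivAt, ← hasFDerivWithinAt_univ, hasFDerivWithinAt_euclidean]
  intro j
  have hlin : ∀ a b : ℂ, HasDerivAt (fun τ : ℂ => a + τ * b) b 0 := fun a b => by
    simpa using ((hasDerivAt_id (0 : ℂ)).mul_const b).const_add a
  have hp : HasDerivAt (fun τ : ℂ => Complex.exp ((s + τ * σ) / 2))
      (Complex.exp (s / 2) * (σ / 2)) 0 := by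
    simpa using ((hlin s σ).div_const 2).cexp
  have hm : HasDerivAt (fun τ : ℂ => Complex.exp (-((s + τ * σ) / 2)))
      (Complex.exp (-(s / 2)) * -(σ / 2)) 0 := by
    simpa using ((hlin s σ).div_const 2).neg.cexp
  suffices h : HasDerivAt (fun τ : ℂ => flowFrame k (s + τ * σ) (Z + τ • W) j)
      (flowFrame k s (W + (σ / 2) • swapField Z) j) 0 by
    refine (h.hasFDerivAt.congr_fderiv ?_).hasFDerivWithinAt
    ext
    simp
  simp only [flowFrame, swapField, Pi.add_apply, Pi.smul_apply, smul_eq_mul]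
  split_ifs with h1 h2
  · refine ((hp.mul ((hlin (Z 0) (W 0)).add
      (hlin (Z (Fin.last (k + 1))) (W (Fin.last (k + 1)))))).div_const (√2 : ℂ)).congr_deriv ?_
    simp
    ring
  · refine ((hm.mul ((hlin (Z 0) (W 0)).sub
      (hlin (Z (Fin.last (k + 1))) (W (Fin.last (k + 1)))))).div_const (√2 : ℂ)).congr_deriv ?_
    simp
    ring
  · simpa using hlin (Z j) (W j)

theorem fderiv_eq_of_hasDerivAt_line {E F : Type*} [NormedAddCommGroup E] [NormedSpace ℂ E]
    [NormedAddCommGroup F] [NormedSpace ℂ F] {g : E → F} {w v : E} {D : F}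
    (hg : DifferentiableAt ℂ g w) (h : HasDerivAt (fun τ : ℂ => g (w + τ • v)) D 0) :
    fderiv ℂ g w v = D := by
  have := hg.hasFDerivAt.hasLineDerivAt v
  exact HasDerivAt.unique this h

theorem contDiffOn_flowPotential :
    ContDiffOn ℝ ∞ (fun p : ℝ × (Fin (k + 2) → ℂ) => flowPotential k p.1 p.2)
      (Set.univ ×ˢ {0}ᶜ) := by
  have h1 : ContDiff ℝ ∞ fun p : ℂ × (Fin (k + 2) → ℂ) => flowFrame k p.1 p.2 :=
    (contDiff_flowFrame contDiff_fst contDiff_snd).restrict_scalars ℝ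
  have h2 : ContDiff ℝ ∞ fun p : ℝ × (Fin (k + 2) → ℂ) => ((p.1 : ℂ), p.2) :=
    (Complex.ofRealCLM.contDiff.comp contDiff_fst).prodMk contDiff_snd
  refine ContDiffOn.log ((h1.comp h2).norm_sq ℂ).contDiffOn ?_
  rintro ⟨t, Z⟩ ⟨-, hZ⟩ h
  exact hZ (flowFrame_eq_zero (by simpa using h))

theorem contDiffOn_flowPotential_apply (t : ℝ) :
    ContDiffOn ℝ ∞ (flowPotential k t) {0}ᶜ := by
  have h1 : ContDiff ℝ ∞ fun Z : Fin (k + 2) → ℂ => flowFrame k t Z :=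
    (contDiff_flowFrame contDiff_const contDiff_id).restrict_scalars ℝ
  refine ContDiffOn.log (h1.norm_sq ℂ).contDiffOn fun Z hZ h => ?_
  exact hZ (flowFrame_eq_zero (by simpa using h))

theorem flowPotential_smul (t : ℝ) {l : ℂ} {Z : Fin (k + 2) → ℂ} (hl : l ≠ 0) (hZ : Z ≠ 0) :
    flowPotential k t (l • Z) = flowPotential k t Z + Real.log (‖l‖ ^ 2) := by
  have hZ' : flowFrame k t Z ≠ 0 := fun h => hZ (flowFrame_eq_zero h)
  rw [flowPotential, flowPotential, flowFrame_smul, norm_smul, mul_pow, Real.log_mul, add_comm]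
  · simpa using hl
  · simpa using hZ'

theorem complexHessian_flowPotential_posDef (t : ℝ) (i : Fin (k + 2)) (z : Fin (k + 1) → ℂ) :
    (complexHessian (fun w => flowPotential k t (affinePoint i w)) z).PosDef := by
  have hc : ContDiff ℂ 2 fun w : Fin (k + 1) → ℂ => flowFrame k t (affinePoint i w) :=
    contDiff_flowFrame contDiff_const ((contDiff_affinePoint i).of_le le_top)
  refine complexHessian_log_normSq_posDef hc
    (fun w h => affinePoint_ne_zero i w (flowFrame_eq_zero h)) z fun v hv c h => ?_
  have hd := hasDerivAt_flowFrame (t : ℂ) 0 (affinePoint i z)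
    (Fin.insertNth (α := fun _ => ℂ) i 0 v)
  simp only [mul_zero, add_zero, zero_div, zero_smul] at hd
  rw [fderiv_eq_of_hasDerivAt_line (hc.differentiable (by norm_num) z)
    (D := flowFrame k t (Fin.insertNth (α := fun _ => ℂ) i 0 v)), ← flowFrame_smul,
    ← sub_eq_zero, ← flowFrame_sub] at h
  · have h' := sub_eq_zero.1 (flowFrame_eq_zero h)
    -- compare the `i`-th coordinates, which are `0` and `c`
    have hc0 : c = 0 := by
      have h1 := congrFun h' i
      simp only [affinePoint, Fin.insertNth_apply_same, Pi.smul_apply, smul_eq_mul, mul_one] at h1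
      exact h1.symm
    refine hv (funext fun j => ?_)
    have h1 := congrFun h' (i.succAbove j)
    rw [hc0, zero_smul] at h1
    simpa only [Fin.insertNth_apply_succAbove, Pi.zero_apply] using h1
  · refine hd.congr_of_eventuallyEq (Filter.Eventually.of_forall fun τ => ?_)
    simp only [affinePoint_add]
    congr 2
    funext j
    refine Fin.succAboveCases i ?_ (fun j => ?_) j <;> simp

theorem isKahlerPotential_flowPotential (t : ℝ) :
    IsKahlerPotential (n := k + 1) (flowPotential k t) where
  smooth := contDiffOn_flowPotential_apply t
  homogeneous _ _ hl hZ := flowPotential_smul t hl hZ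
  positive := complexHessian_flowPotential_posDef t

/-- On the leaves `s ↦ exp (-s A / 2) Z` the vector `exp (s A / 2) Z` moves along a complex line
only. Their tangent direction in an affine chart is therefore a null vector of the complex
Hessian. -/
theorem isGeodesic_flowPotential (a b : ℝ) : IsGeodesic (n := k + 1) a b (flowPotential k) where
  smooth := contDiffOn_flowPotential.mono (Set.prod_mono (Set.subset_univ _) subset_rfl)
  kahler t _ := isKahlerPotential_flowPotential t
  monge_ampere i w _ := by
    set f : (Fin (k + 2) → ℂ) → EuclideanSpace ℂ (Fin (k + 2)) :=
      fun v => flowFrame k (v 0) (affinePoint i (Fin.tail v)) with hf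
    have htail : ContDiff ℂ 2 (Fin.tail : (Fin (k + 2) → ℂ) → Fin (k + 1) → ℂ) :=
      contDiff_pi.2 fun j => contDiff_apply ℂ ℂ j.succ
    have hc : ContDiff ℂ 2 f :=
      contDiff_flowFrame (contDiff_apply ℂ ℂ 0)
        (((contDiff_affinePoint i).of_le le_top).comp htail)
    have hu : (fun v : Fin (k + 2) → ℂ =>
        flowPotential k (v 0).re (affinePoint i (Fin.tail v))) =
        fun v => Real.log (‖f v‖ ^ 2) := by
      funext v
      rw [flowPotential, flowFrame_re]
    rw [hu]
    set Z := affinePoint i (Fin.tail w) with hZ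
    -- the multiple of `Z` is chosen so that `W` is tangent to the chart `{Zᵢ = 1}`
    set c : ℂ := swapField Z i / 2 with hcdef
    set W : Fin (k + 2) → ℂ := c • Z - (1 / 2 : ℂ) • swapField Z with hW
    have hWi : W i = 0 := by
      simp [hW, hZ, affinePoint, hcdef]
      ring
    have hWins : Fin.insertNth (α := fun _ => ℂ) i 0 (fun j => W (i.succAbove j)) = W := by
      funext j
      refine Fin.succAboveCases i ?_ (fun j => ?_) j <;> simp [hWi]
    refine complexHessian_log_normSq_det_eq_zero hc
      (fun v h => affinePoint_ne_zero i _ (flowFrame_eq_zero h))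
      (v := Fin.cons 1 fun j => W (i.succAbove j)) (c := c) ?_ ?_
    · intro h
      simpa using congrFun h 0
    · have hd := hasDerivAt_flowFrame (w 0) 1 Z W
      have e : W + (1 / 2 : ℂ) • swapField Z = c • Z := by rw [hW]; abel
      rw [e, flowFrame_smul] at hd
      refine fderiv_eq_of_hasDerivAt_line (hc.differentiable (by norm_num) w)
        (hd.congr_of_eventuallyEq (Filter.Eventually.of_forall fun τ => ?_))
      have e1 : Fin.tail (w + τ • (Fin.cons 1 fun j => W (i.succAbove j) : Fin (k + 2) → ℂ)) =
          Fin.tail w + τ • fun j => W (i.succAbove j) := by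
        funext j
        simp [Fin.tail]
      simp only [hf, e1, affinePoint_add]
      congr 1
      congr 1
      conv_rhs => rw [← hWins]
      funext j
      refine Fin.succAboveCases i ?_ (fun j => ?_) j <;> simp

theorem star_dotProduct_coshCurve_mulVec (t : ℝ) (Z : Fin 2 → ℂ) :
    star Z ⬝ᵥ (coshCurve t).mulVec Z = ((‖flowFrame 0 t Z‖ ^ 2 : ℝ) : ℂ) := by
  have hl : Fin.last (0 + 1) = (1 : Fin 2) := rfl
  rw [norm_flowFrame_sq]
  simp only [Fin.sum_univ_zero, hl, coshCurve, Complex.ofReal_re, zero_add,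
    ← Complex.normSq_eq_norm_sq, Complex.normSq_apply, dotProduct, Matrix.mulVec]
  apply Complex.ext
  · rw [Complex.ofReal_re]
    simp [Fin.sum_univ_two, -Complex.ofReal_cosh, -Complex.ofReal_sinh]
    rw [Real.cosh_eq, Real.sinh_eq]
    ring
  · rw [Complex.ofReal_im]
    simp [Fin.sum_univ_two, -Complex.ofReal_cosh, -Complex.ofReal_sinh]
    ring

theorem flowPotential_eq_fubiniStudy (t : ℝ) :
    flowPotential 0 t = fubiniStudy (n := 1) (coshCurve t) := by
  funext Z
  rw [flowPotential, fubiniStudy, star_dotProduct_coshCurve_mulVec, Complex.ofReal_re]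

end Flow

open MeasureTheory

/-! ### Gaussian weights on `ℂᴺ` -/

section Gaussian

theorem integral_norm_pow_mul_exp (a : ℕ) {d : ℝ} (hd : 0 < d) :
    ∫ w : ℂ, ‖w‖ ^ (2 * a) * Real.exp (-(d * ‖w‖ ^ 2)) =
      Real.pi * a.factorial / d ^ (a + 1) := by
  have h := Complex.integral_rpow_mul_exp_neg_mul_rpow (p := 2) (q := 2 * a) (b := d)
    (by norm_num) (by have : (0 : ℝ) ≤ a := a.cast_nonneg
                      linarith) hd
  have e1 : -((2 : ℝ) * a + 2) / 2 = -((a + 1 : ℕ) : ℝ) := by push_cast; ring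
  have e2 : ((2 : ℝ) * a + 2) / 2 = a + 1 := by ring
  rw [e1, e2, Real.rpow_neg hd.le, Real.rpow_natCast, Real.Gamma_nat_eq_factorial] at h
  have e3 : ∀ w : ℂ, ‖w‖ ^ (2 * a) * Real.exp (-(d * ‖w‖ ^ 2)) =
      ‖w‖ ^ ((2 : ℝ) * a) * Real.exp (-d * ‖w‖ ^ (2 : ℝ)) := fun w => by
    rw [show (2 : ℝ) * a = ((2 * a : ℕ) : ℝ) by push_cast; ring, Real.rpow_natCast,
      Real.rpow_two, neg_mul]
  simp only [e3, h]
  field_simp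

theorem integrable_norm_pow_mul_exp (a : ℕ) {d : ℝ} (hd : 0 < d) :
    Integrable fun w : ℂ => ‖w‖ ^ (2 * a) * Real.exp (-(d * ‖w‖ ^ 2)) := by
  refine Integrable.of_integral_ne_zero ?_
  rw [integral_norm_pow_mul_exp a hd]
  positivity

/-- The monomials `wᵇ` are pairwise orthogonal for a Gaussian weight, by rotation invariance. -/
theorem integral_pow_mul_conj_pow_mul_exp (b a : ℕ) {d : ℝ} (hd : 0 < d) :
    ∫ w : ℂ, w ^ b * starRingEnd ℂ w ^ a * (Real.exp (-(d * ‖w‖ ^ 2)) : ℂ) =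
      if b = a then ((Real.pi * a.factorial / d ^ (a + 1) : ℝ) : ℂ) else 0 := by
  split_ifs with hab
  · subst hab
    rw [← integral_norm_pow_mul_exp b hd, ← integral_complex_ofReal]
    refine integral_congr_ae (Filter.Eventually.of_forall fun w => ?_)
    simp only
    rw [← mul_pow, Complex.mul_conj']
    push_cast
    ring
  · have hba : (b : ℝ) - a ≠ 0 := sub_ne_zero.2 (by exact_mod_cast hab)
    -- rotation by `π / (b - a)` changes the sign of the integrand
    set c : Circle := Circle.exp (Real.pi / (b - a)) with hc
    have hcc : (c : ℂ) ^ b * starRingEnd ℂ (c : ℂ) ^ a = -1 := by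
      have hba' : (b : ℂ) - a ≠ 0 := by exact_mod_cast hba
      rw [hc, Circle.coe_exp, ← Complex.exp_conj, ← Complex.exp_nat_mul, ← Complex.exp_nat_mul,
        ← Complex.exp_add, ← Complex.exp_pi_mul_I, map_mul, Complex.conj_ofReal, Complex.conj_I]
      congr 1
      push_cast
      field_simp
      ring
    have hmp : MeasurePreserving (rotation c) (volume : Measure ℂ) volume :=
      (rotation c).measurePreserving
    have hint := hmp.integral_comp (rotation c).toHomeomorph.measurableEmbedding
      (fun w : ℂ => w ^ b * starRingEnd ℂ w ^ a * (Real.exp (-(d * ‖w‖ ^ 2)) : ℂ))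
    have e : ∀ w : ℂ, (rotation c w) ^ b * starRingEnd ℂ (rotation c w) ^ a *
        (Real.exp (-(d * ‖rotation c w‖ ^ 2)) : ℂ) =
        -(w ^ b * starRingEnd ℂ w ^ a * (Real.exp (-(d * ‖w‖ ^ 2)) : ℂ)) := fun w => by
      rw [LinearIsometryEquiv.norm_map, rotation_apply, map_mul, mul_pow, mul_pow]
      linear_combination (w ^ b * starRingEnd ℂ w ^ a * (Real.exp (-(d * ‖w‖ ^ 2)) : ℂ)) * hcc
    simp only [e, integral_neg] at hint
    exact self_eq_neg.1 hint.symm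

variable {N : ℕ} {d : Fin N → ℝ}

/-- The Gaussian weight `exp (-∑ᵢ dᵢ |Wᵢ|²)`. -/
def gaussWeight (d : Fin N → ℝ) (W : Fin N → ℂ) : ℝ :=
  Real.exp (-∑ i, d i * ‖W i‖ ^ 2)

/-- The squared norm of the monomial with exponent `γ` for the Gaussian weight, see
`integral_norm_monomial_sq`. -/
def gaussMonomialNormSq (d : Fin N → ℝ) (γ : Fin N →₀ ℕ) : ℝ :=
  ∏ i, Real.pi * (γ i).factorial / d i ^ (γ i + 1)

theorem gaussMonomialNormSq_pos (hd : ∀ i, 0 < d i) (γ : Fin N →₀ ℕ) :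
    0 < gaussMonomialNormSq d γ :=
  Finset.prod_pos fun i _ => by have := hd i; positivity

theorem continuous_gaussWeight : Continuous (gaussWeight d) := by
  unfold gaussWeight
  fun_prop

theorem gaussWeight_pos (W : Fin N → ℂ) : 0 < gaussWeight d W := Real.exp_pos _

theorem prod_pow_mul_conj_mul_gaussWeight (β γ : Fin N → ℕ) (W : Fin N → ℂ) :
    (∏ i, W i ^ β i) * starRingEnd ℂ (∏ i, W i ^ γ i) * (gaussWeight d W : ℂ) =
      ∏ i, (W i ^ β i * starRingEnd ℂ (W i) ^ γ i * (Real.exp (-(d i * ‖W i‖ ^ 2)) : ℂ)) := by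
  rw [Finset.prod_mul_distrib, Finset.prod_mul_distrib, gaussWeight, ← Finset.sum_neg_distrib,
    Real.exp_sum, map_prod, Complex.ofReal_prod]
  simp only [map_pow]

theorem integral_monomial_mul_conj (hd : ∀ i, 0 < d i) (β γ : Fin N →₀ ℕ) :
    ∫ W : Fin N → ℂ, (∏ i, W i ^ β i) * starRingEnd ℂ (∏ i, W i ^ γ i) * (gaussWeight d W : ℂ) =
      if β = γ then (gaussMonomialNormSq d γ : ℂ) else 0 := by
  simp only [prod_pow_mul_conj_mul_gaussWeight]
  rw [integral_fintype_prod_volume_eq_prod (fun i (w : ℂ) =>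
    w ^ β i * starRingEnd ℂ w ^ γ i * (Real.exp (-(d i * ‖w‖ ^ 2)) : ℂ))]
  simp only [integral_pow_mul_conj_pow_mul_exp _ _ (hd _)]
  split_ifs with h
  · subst h
    simp [gaussMonomialNormSq]
  · obtain ⟨i, hi⟩ := DFunLike.ne_iff.1 h
    exact Finset.prod_eq_zero (Finset.mem_univ i) (if_neg hi)

theorem integrable_monomial_mul_conj (hd : ∀ i, 0 < d i) (β γ : Fin N →₀ ℕ) :
    Integrable fun W : Fin N → ℂ =>
      (∏ i, W i ^ β i) * starRingEnd ℂ (∏ i, W i ^ γ i) * (gaussWeight d W : ℂ) := by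
  simp only [prod_pow_mul_conj_mul_gaussWeight]
  refine Integrable.fintype_prod (f := fun i (w : ℂ) =>
    w ^ β i * starRingEnd ℂ w ^ γ i * (Real.exp (-(d i * ‖w‖ ^ 2)) : ℂ)) fun i => ?_
  refine ((integrable_norm_pow_mul_exp (β i) (hd i)).add
    (integrable_norm_pow_mul_exp (γ i) (hd i))).mono' (by fun_prop)
    (Filter.Eventually.of_forall fun w => ?_)
  rw [norm_mul, norm_mul, norm_pow, norm_pow, RCLike.norm_conj, Complex.norm_real,
    Real.norm_eq_abs, Real.abs_exp, Pi.add_apply, ← add_mul]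
  gcongr
  have := two_mul_le_add_sq (‖w‖ ^ β i) (‖w‖ ^ γ i)
  have h1 : 0 ≤ ‖w‖ ^ β i * ‖w‖ ^ γ i := by positivity
  calc ‖w‖ ^ β i * ‖w‖ ^ γ i ≤ (‖w‖ ^ β i) ^ 2 + (‖w‖ ^ γ i) ^ 2 := by linarith
    _ = _ := by ring

theorem integrable_eval_mul_conj (hd : ∀ i, 0 < d i) (p q : MvPolynomial (Fin N) ℂ) :
    Integrable fun W : Fin N → ℂ =>
      MvPolynomial.eval W p * starRingEnd ℂ (MvPolynomial.eval W q) * (gaussWeight d W : ℂ) := by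
  simp only [MvPolynomial.eval_eq', map_sum, Finset.sum_mul, Finset.mul_sum]
  refine integrable_finsetSum _ fun γ _ => integrable_finsetSum _ fun β _ => ?_
  refine ((integrable_monomial_mul_conj hd β γ).const_mul
    (p.coeff β * starRingEnd ℂ (q.coeff γ))).congr (Filter.Eventually.of_forall fun W => ?_)
  simp only [map_mul]
  ring

theorem integral_eval_mul_conj_monomial (hd : ∀ i, 0 < d i) (p : MvPolynomial (Fin N) ℂ)
    (γ : Fin N →₀ ℕ) :
    ∫ W : Fin N → ℂ, MvPolynomial.eval W p * starRingEnd ℂ (∏ i, W i ^ γ i) *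
      (gaussWeight d W : ℂ) = p.coeff γ * gaussMonomialNormSq d γ := by
  have e : ∀ W : Fin N → ℂ, MvPolynomial.eval W p * starRingEnd ℂ (∏ i, W i ^ γ i) *
      (gaussWeight d W : ℂ) = ∑ β ∈ p.support, p.coeff β *
        ((∏ i, W i ^ β i) * starRingEnd ℂ (∏ i, W i ^ γ i) * (gaussWeight d W : ℂ)) := fun W => by
    rw [MvPolynomial.eval_eq', Finset.sum_mul, Finset.sum_mul]
    exact Finset.sum_congr rfl fun β _ => by ring
  simp only [e]
  rw [integral_finsetSum _ fun β _ => (integrable_monomial_mul_conj hd β γ).const_mul _]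
  simp only [integral_const_mul, integral_monomial_mul_conj hd, mul_ite, mul_zero]
  rw [Finset.sum_ite_eq' p.support γ]
  split_ifs with h
  · rfl
  · rw [MvPolynomial.notMem_support_iff.1 h, zero_mul]

theorem integrable_norm_eval_sq_mul_gaussWeight (hd : ∀ i, 0 < d i)
    (p : MvPolynomial (Fin N) ℂ) :
    Integrable fun W : Fin N → ℂ => ‖MvPolynomial.eval W p‖ ^ 2 * gaussWeight d W := by
  refine (integrable_eval_mul_conj hd p p).norm.congr (Filter.Eventually.of_forall fun W => ?_)
  simp only [norm_mul, RCLike.norm_conj, Complex.norm_real, Real.norm_eq_abs,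
    abs_of_pos (gaussWeight_pos W)]
  ring

theorem integral_norm_monomial_sq (hd : ∀ i, 0 < d i) (γ : Fin N →₀ ℕ) :
    ∫ W : Fin N → ℂ, ‖∏ i, W i ^ γ i‖ ^ 2 * gaussWeight d W = gaussMonomialNormSq d γ := by
  have h := integral_monomial_mul_conj hd γ γ
  rw [if_pos rfl] at h
  rw [← Complex.ofReal_inj, ← h, ← integral_complex_ofReal]
  refine integral_congr_ae (Filter.Eventually.of_forall fun W => ?_)
  simp only [Complex.mul_conj']
  push_cast
  rfl

/-- Among the polynomials in which a given monomial has coefficient `1`, that monomial has the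
smallest Gaussian norm. -/
theorem gaussMonomialNormSq_le (hd : ∀ i, 0 < d i) {p : MvPolynomial (Fin N) ℂ}
    {γ : Fin N →₀ ℕ} (hp : p.coeff γ = 1) :
    gaussMonomialNormSq d γ ≤
      ∫ W : Fin N → ℂ, ‖MvPolynomial.eval W p‖ ^ 2 * gaussWeight d W := by
  -- integrate `2 Re (p · conj zᵞ) - |zᵞ|² ≤ |p|²`
  have h1 := integral_eval_mul_conj_monomial hd p γ
  rw [hp, one_mul] at h1
  have hmon : ∀ W : Fin N → ℂ,
      MvPolynomial.eval W (MvPolynomial.monomial γ (1 : ℂ)) = ∏ i, W i ^ γ i := fun W => by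
    rw [MvPolynomial.eval_monomial, one_mul, Finsupp.prod_fintype _ _ (fun i => pow_zero _)]
  have i1 := integrable_eval_mul_conj hd p (MvPolynomial.monomial γ (1 : ℂ))
  have i2 := integrable_norm_eval_sq_mul_gaussWeight hd (MvPolynomial.monomial γ (1 : ℂ))
  simp only [hmon] at i1 i2
  have i1' : Integrable fun W : Fin N → ℂ => (MvPolynomial.eval W p *
      starRingEnd ℂ (∏ i, W i ^ γ i) * (gaussWeight d W : ℂ)).re := i1.re
  have h2 : ∫ W : Fin N → ℂ, (MvPolynomial.eval W p * starRingEnd ℂ (∏ i, W i ^ γ i) *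
      (gaussWeight d W : ℂ)).re = gaussMonomialNormSq d γ := by
    have := integral_re i1
    simp only [RCLike.re_to_complex] at this
    rw [this, h1, Complex.ofReal_re]
  calc gaussMonomialNormSq d γ
      = ∫ W : Fin N → ℂ, (2 * (MvPolynomial.eval W p * starRingEnd ℂ (∏ i, W i ^ γ i) *
        (gaussWeight d W : ℂ)).re - ‖∏ i, W i ^ γ i‖ ^ 2 * gaussWeight d W) := by
        rw [integral_sub (i1'.const_mul 2) i2, integral_const_mul, h2,
          integral_norm_monomial_sq hd]
        ring
    _ ≤ _ := by
        refine integral_mono ((i1'.const_mul 2).sub i2)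
          (integrable_norm_eval_sq_mul_gaussWeight hd p) fun W => ?_
        simp only
        generalize MvPolynomial.eval W p = x
        generalize ∏ i, W i ^ γ i = y
        have hx := Complex.normSq_sub x y
        have hnn := Complex.normSq_nonneg (x - y)
        simp only [Complex.normSq_eq_norm_sq] at hx hnn
        have hw := (gaussWeight_pos (d := d) W).le
        rw [Complex.re_mul_ofReal]
        nlinarith

end Gaussian

/-! ### Passage from the cone `ℂⁿ⁺¹` to `ℙⁿ` -/

section Fock

variable {n : ℕ}

theorem map_volume_linear {N : ℕ} (f : (Fin N → ℂ) →ₗ[ℂ] (Fin N → ℂ))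
    (hf : LinearMap.det f ≠ 0) :
    (volume : Measure (Fin N → ℂ)).map f =
      ENNReal.ofReal (‖LinearMap.det f‖ ^ 2)⁻¹ • volume := by
  have hdet : LinearMap.det (f.restrictScalars ℝ) = ‖LinearMap.det f‖ ^ 2 := by
    rw [LinearMap.det_restrictScalars, Algebra.norm_complex_apply, Complex.normSq_eq_norm_sq]
  have h := Measure.map_linearMap_addHaar_eq_smul_addHaar (volume : Measure (Fin N → ℂ))
    (f := f.restrictScalars ℝ) (by rw [hdet]; simpa using hf)
  rw [hdet, abs_of_nonneg (by positivity)] at h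
  exact h

theorem measurePreserving_linear {N : ℕ} (f : (Fin N → ℂ) →ₗ[ℂ] (Fin N → ℂ))
    (hf : LinearMap.det f = 1) : MeasurePreserving f (volume : Measure (Fin N → ℂ)) volume where
  measurable := f.continuous_of_finiteDimensional.measurable
  map_eq := by rw [map_volume_linear f (by simp [hf]), hf]; simp

theorem lintegral_comp_smul {c : ℂ} (hc : c ≠ 0) {f : (Fin n → ℂ) → ENNReal}
    (hf : Measurable f) :
    ∫⁻ z : Fin n → ℂ, f z = ENNReal.ofReal (‖c‖ ^ (2 * n)) * ∫⁻ z : Fin n → ℂ, f (c • z) := by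
  have hdet : LinearMap.det (c • (LinearMap.id : (Fin n → ℂ) →ₗ[ℂ] (Fin n → ℂ))) = c ^ n := by
    simp
  have h := map_volume_linear (c • (LinearMap.id : (Fin n → ℂ) →ₗ[ℂ] (Fin n → ℂ)))
    (by rw [hdet]; exact pow_ne_zero _ hc)
  have h2 := lintegral_map hf
    (c • (LinearMap.id : (Fin n → ℂ) →ₗ[ℂ] (Fin n → ℂ))).continuous_of_finiteDimensional.measurable
    (μ := volume)
  rw [h, lintegral_smul_measure, hdet] at h2
  simp only [LinearMap.smul_apply, LinearMap.id_apply] at h2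
  rw [← h2, smul_eq_mul, ← mul_assoc, ← ENNReal.ofReal_mul (by positivity), norm_pow, ← pow_mul,
    mul_comm n 2, mul_inv_cancel₀ (pow_ne_zero _ (norm_ne_zero_iff.2 hc)), ENNReal.ofReal_one,
    one_mul]

theorem smul_affinePoint_last (c : ℂ) (z : Fin n → ℂ) :
    Fin.insertNth (α := fun _ => ℂ) (Fin.last n) c (c • z) = c • affinePoint (Fin.last n) z := by
  funext j
  refine Fin.succAboveCases (Fin.last n) ?_ (fun j => ?_) j
  · simp [affinePoint]
  · simp only [affinePoint, Pi.smul_apply, Fin.insertNth_apply_succAbove]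

/-- Integration over `ℂⁿ⁺¹` along the lines through the points of the chart `{Zₙ ≠ 0}`. -/
theorem lintegral_eq_lintegral_affinePoint {f : (Fin (n + 1) → ℂ) → ENNReal} (hf : Measurable f) :
    ∫⁻ Z, f Z = ∫⁻ z : Fin n → ℂ, ∫⁻ c : ℂ,
      ENNReal.ofReal (‖c‖ ^ (2 * n)) * f (c • affinePoint (Fin.last n) z) := by
  have hmp := volume_preserving_piFinSuccAbove (fun _ : Fin (n + 1) => ℂ) (Fin.last n)
  have hins : Measurable fun p : ℂ × (Fin n → ℂ) =>
      Fin.insertNth (α := fun _ => ℂ) (Fin.last n) p.1 p.2 :=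
    (MeasurableEquiv.piFinSuccAbove (fun _ : Fin (n + 1) => ℂ) (Fin.last n)).symm.measurable
  have haff : Measurable (affinePoint (Fin.last n)) :=
    hins.comp (measurable_const.prodMk measurable_id)
  have hsm : Measurable fun p : ℂ × (Fin n → ℂ) => p.1 • affinePoint (Fin.last n) p.2 :=
    measurable_fst.smul (haff.comp measurable_snd)
  calc ∫⁻ Z, f Z
      = ∫⁻ p : ℂ × (Fin n → ℂ), f (Fin.insertNth (α := fun _ => ℂ) (Fin.last n) p.1 p.2) :=
        (hmp.symm.lintegral_comp hf).symm
    _ = ∫⁻ c : ℂ, ∫⁻ z : Fin n → ℂ, f (Fin.insertNth (α := fun _ => ℂ) (Fin.last n) c z) :=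
        lintegral_prod _ (hf.comp hins).aemeasurable
    _ = ∫⁻ c : ℂ, ∫⁻ z : Fin n → ℂ,
          ENNReal.ofReal (‖c‖ ^ (2 * n)) * f (c • affinePoint (Fin.last n) z) := by
        refine lintegral_congr_ae ?_
        have h0 : ∀ᵐ c : ℂ, c ≠ 0 := by simp [ae_iff]
        filter_upwards [h0] with c hc
        have m1 : Measurable fun z : Fin n → ℂ =>
            f (Fin.insertNth (α := fun _ => ℂ) (Fin.last n) c z) :=
          hf.comp (hins.comp (measurable_const.prodMk measurable_id))
        have m2 : Measurable fun z : Fin n → ℂ => f (c • affinePoint (Fin.last n) z) :=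
          hf.comp (hsm.comp (measurable_const.prodMk measurable_id))
        rw [lintegral_comp_smul hc m1, lintegral_const_mul _ m2]
        simp only [smul_affinePoint_last]
    _ = _ := by
        refine lintegral_lintegral_swap (Measurable.aemeasurable ?_)
        exact (ENNReal.measurable_ofReal.comp (measurable_fst.norm.pow_const _)).mul (hf.comp hsm)

theorem sum_eq_of_isHomogeneous {σ : Type*} [Fintype σ] {m : ℕ} {s : MvPolynomial σ ℂ}
    (hs : s.IsHomogeneous m) {β : σ →₀ ℕ} (hβ : s.coeff β ≠ 0) : ∑ i, β i = m := by
  rw [← Finsupp.degree_eq_sum, Finsupp.degree_eq_weight_one]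
  exact hs hβ

theorem eval_smul_of_isHomogeneous {σ : Type*} [Fintype σ] {m : ℕ} {s : MvPolynomial σ ℂ}
    (hs : s.IsHomogeneous m) (c : ℂ) (Z : σ → ℂ) :
    MvPolynomial.eval (c • Z) s = c ^ m * MvPolynomial.eval Z s := by
  rw [MvPolynomial.eval_eq', MvPolynomial.eval_eq', Finset.mul_sum]
  refine Finset.sum_congr rfl fun β hβ => ?_
  simp only [Pi.smul_apply, smul_eq_mul, mul_pow, Finset.prod_mul_distrib,
    Finset.prod_pow_eq_pow_sum, sum_eq_of_isHomogeneous hs (MvPolynomial.mem_support_iff.1 hβ)]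
  ring

/-- For a homogeneous polynomial, the norm with weight `e^{-h}` on the cone is, up to a constant
that depends on the degree only, the norm on `ℙⁿ` for the metric `1 / hᵐ` and the volume form
`h⁻⁽ⁿ⁺¹⁾`: integrate over each line through the origin. -/
theorem integral_eval_affinePoint {h : (Fin (n + 1) → ℂ) → ℝ} (hcont : Continuous h)
    (hpos : ∀ Z, Z ≠ 0 → 0 < h Z) (hsmul : ∀ (c : ℂ) Z, h (c • Z) = ‖c‖ ^ 2 * h Z)
    {m : ℕ} {s : MvPolynomial (Fin (n + 1)) ℂ} (hs : s.IsHomogeneous m) :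
    ∫ Z, ‖MvPolynomial.eval Z s‖ ^ 2 * Real.exp (-h Z) =
      Real.pi * (m + n).factorial * ∫ z : Fin n → ℂ,
        ‖MvPolynomial.eval (affinePoint (Fin.last n) z) s‖ ^ 2 /
          h (affinePoint (Fin.last n) z) ^ (m + n + 1) := by
  have hev : Continuous fun Z : Fin (n + 1) → ℂ => MvPolynomial.eval Z s :=
    MvPolynomial.continuous_eval s
  have haff : Continuous (affinePoint (Fin.last n)) := (contDiff_affinePoint _).continuous
  have hint : ∀ z : Fin n → ℂ, ∫⁻ c : ℂ, ENNReal.ofReal (‖c‖ ^ (2 * n)) * ENNReal.ofReal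
      (‖MvPolynomial.eval (c • affinePoint (Fin.last n) z) s‖ ^ 2 *
        Real.exp (-h (c • affinePoint (Fin.last n) z))) =
      ENNReal.ofReal (Real.pi * (m + n).factorial *
        (‖MvPolynomial.eval (affinePoint (Fin.last n) z) s‖ ^ 2 /
          h (affinePoint (Fin.last n) z) ^ (m + n + 1))) := fun z => by
    set A := affinePoint (Fin.last n) z with hA
    have hAh : 0 < h A := hpos A (affinePoint_ne_zero _ _)
    have e : ∀ c : ℂ, ENNReal.ofReal (‖c‖ ^ (2 * n)) * ENNReal.ofReal
        (‖MvPolynomial.eval (c • A) s‖ ^ 2 * Real.exp (-h (c • A))) =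
        ENNReal.ofReal (‖MvPolynomial.eval A s‖ ^ 2 *
          (‖c‖ ^ (2 * (m + n)) * Real.exp (-(h A * ‖c‖ ^ 2)))) := fun c => by
      have hsc : MvPolynomial.eval (c • A) s = c ^ m * MvPolynomial.eval A s :=
        eval_smul_of_isHomogeneous hs c A
      rw [← ENNReal.ofReal_mul (by positivity), hsc, hsmul, norm_mul, norm_pow,
        mul_comm (‖c‖ ^ 2) (h A)]
      congr 1
      ring
    simp only [e]
    rw [← ofReal_integral_eq_lintegral_ofReal
      ((integrable_norm_pow_mul_exp (m + n) hAh).const_mul _)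
      (Filter.Eventually.of_forall fun c => by positivity), integral_const_mul,
      integral_norm_pow_mul_exp (m + n) hAh]
    congr 1
    ring
  have hcont2 : Continuous fun z : Fin n → ℂ =>
      ‖MvPolynomial.eval (affinePoint (Fin.last n) z) s‖ ^ 2 /
        h (affinePoint (Fin.last n) z) ^ (m + n + 1) :=
    ((hev.comp haff).norm.pow 2).div ((hcont.comp haff).pow _) fun z =>
      pow_ne_zero _ (hpos _ (affinePoint_ne_zero _ _)).ne'
  have hcont1 : Continuous fun Z : Fin (n + 1) → ℂ =>
      ‖MvPolynomial.eval Z s‖ ^ 2 * Real.exp (-h Z) := (hev.norm.pow 2).mul hcont.neg.rexp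
  have hcont3 : Continuous fun z : Fin n → ℂ => Real.pi * (m + n).factorial *
      (‖MvPolynomial.eval (affinePoint (Fin.last n) z) s‖ ^ 2 /
        h (affinePoint (Fin.last n) z) ^ (m + n + 1)) := continuous_const.mul hcont2
  rw [← integral_const_mul, integral_eq_lintegral_of_nonneg_ae
    (Filter.Eventually.of_forall fun Z => by positivity)
    hcont1.aestronglyMeasurable,
    integral_eq_lintegral_of_nonneg_ae
    (Filter.Eventually.of_forall fun z => by
      have := hpos _ (affinePoint_ne_zero (Fin.last n) z)
      positivity) hcont3.aestronglyMeasurable,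
    lintegral_eq_lintegral_affinePoint hcont1.measurable.ennreal_ofReal]
  simp only [hint]

end Fock

/-! ### Sections in the chart `{Zₙ ≠ 0}` -/

section Exponents

open MvPolynomial

variable {n : ℕ}

/-- The exponent of the homogeneous monomial of degree `m` whose expression in the chart
`{Zₙ ≠ 0}` is `zᵃ`. -/
def homExponent (m : ℕ) (a : Fin n →₀ ℕ) : Fin (n + 1) →₀ ℕ :=
  Finsupp.equivFunOnFinite.symm
    (Fin.insertNth (α := fun _ => ℕ) (Fin.last n) (m - ∑ i, a i) a)

@[simp]
theorem homExponent_last (m : ℕ) (a : Fin n →₀ ℕ) :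
    homExponent m a (Fin.last n) = m - ∑ i, a i := by
  simp [homExponent]

@[simp]
theorem homExponent_succAbove (m : ℕ) (a : Fin n →₀ ℕ) (i : Fin n) :
    homExponent m a ((Fin.last n).succAbove i) = a i := by
  rw [homExponent, Finsupp.equivFunOnFinite_symm_apply_apply, Fin.insertNth_apply_succAbove]

theorem sum_homExponent {m : ℕ} {a : Fin n →₀ ℕ} (h : ∑ i, a i ≤ m) :
    ∑ j, homExponent m a j = m := by
  rw [Fin.sum_univ_succAbove _ (Fin.last n)]
  simp only [homExponent_last, homExponent_succAbove]
  omega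

/-- The exponent in the chart `{Zₙ ≠ 0}` of a homogeneous monomial. -/
def chartExponent (β : Fin (n + 1) →₀ ℕ) : Fin n →₀ ℕ :=
  Finsupp.equivFunOnFinite.symm fun i => β ((Fin.last n).succAbove i)

@[simp]
theorem chartExponent_apply (β : Fin (n + 1) →₀ ℕ) (i : Fin n) :
    chartExponent β i = β ((Fin.last n).succAbove i) := rfl

theorem chartExponent_eq_iff {m : ℕ} {β : Fin (n + 1) →₀ ℕ} (hβ : ∑ j, β j = m)
    (a : Fin n →₀ ℕ) : chartExponent β = a ↔ ∑ i, a i ≤ m ∧ β = homExponent m a := by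
  rw [Fin.sum_univ_succAbove _ (Fin.last n)] at hβ
  constructor
  · rintro rfl
    simp only [chartExponent_apply]
    refine ⟨by omega, Finsupp.ext fun j => ?_⟩
    refine Fin.succAboveCases (Fin.last n) ?_ (fun j => ?_) j
    · simp only [homExponent_last, chartExponent_apply]
      omega
    · simp only [homExponent_succAbove, chartExponent_apply]
  · rintro ⟨-, rfl⟩
    ext i
    simp only [homExponent_succAbove, chartExponent_apply]

theorem localExpr_monomial (β : Fin (n + 1) →₀ ℕ) (c : ℂ) :
    localExpr (monomial β c) = monomial (chartExponent β) c := by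
  rw [localExpr, aeval_monomial, Finsupp.prod_fintype _ _ (fun i => pow_zero _),
    Fin.prod_univ_succAbove _ (Fin.last n), monomial_eq, Finsupp.prod_fintype _ _
    (fun i => pow_zero _)]
  simp only [Fin.insertNth_apply_same, one_pow, one_mul, Fin.insertNth_apply_succAbove,
    chartExponent_apply]
  rfl

theorem coeff_localExpr {m : ℕ} {s : MvPolynomial (Fin (n + 1)) ℂ} (hs : s.IsHomogeneous m)
    (a : Fin n →₀ ℕ) :
    (localExpr s).coeff a = if ∑ i, a i ≤ m then s.coeff (homExponent m a) else 0 := by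
  have e : localExpr s = ∑ β ∈ s.support, monomial (chartExponent β) (s.coeff β) := by
    conv_lhs => rw [s.as_sum]
    rw [localExpr, map_sum]
    exact Finset.sum_congr rfl fun β _ => localExpr_monomial β _
  rw [e, coeff_sum]
  simp only [coeff_monomial]
  split_ifs with h
  · have : ∀ β ∈ s.support, (if chartExponent β = a then s.coeff β else 0) =
        if β = homExponent m a then s.coeff β else 0 := fun β hβ => by
      simp only [chartExponent_eq_iff (sum_eq_of_isHomogeneous hs (mem_support_iff.1 hβ)), h,
        true_and]
    rw [Finset.sum_congr rfl this, Finset.sum_ite_eq']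
    split_ifs with h'
    · rfl
    · exact (notMem_support_iff.1 h').symm
  · refine Finset.sum_eq_zero fun β hβ => if_neg fun hc => h ?_
    exact ((chartExponent_eq_iff (sum_eq_of_isHomogeneous hs (mem_support_iff.1 hβ)) a).1 hc).1

theorem isHomogeneous_monomial_homExponent {m : ℕ} {a : Fin n →₀ ℕ} (h : ∑ i, a i ≤ m) (c : ℂ) :
    (monomial (homExponent m a) c).IsHomogeneous m :=
  isHomogeneous_monomial c (by rw [Finsupp.degree_eq_sum, sum_homExponent h])

theorem mem_orderSet_iff {m : ℕ} {a : Fin n →₀ ℕ} : a ∈ orderSet n m ↔ ∑ i, a i ≤ m := by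
  constructor
  · rintro ⟨s, hs, ha, -⟩
    rw [coeff_localExpr hs] at ha
    by_contra h
    exact ha (if_neg h)
  · intro h
    have hs := isHomogeneous_monomial_homExponent h 1
    refine ⟨_, hs, ?_, fun b hb => ?_⟩
    · rw [coeff_localExpr hs, if_pos h, coeff_monomial, if_pos rfl]
      exact one_ne_zero
    · rw [localExpr_monomial, coeff_monomial] at hb
      have : chartExponent (homExponent m a) = b := by
        by_contra hc
        exact hb (if_neg hc)
      rw [← this, (chartExponent_eq_iff (sum_homExponent h) a).2 ⟨h, rfl⟩]

end Exponents

/-! ### A unipotent substitution that preserves the flag -/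

section Shear

open MvPolynomial

variable {k : ℕ}

/-- The unipotent linear map `Zₙ ↦ Zₙ + τ Z₀`, which preserves the flag; here `n = k + 1`. -/
def shear (k : ℕ) (τ : ℂ) : (Fin (k + 2) → ℂ) →ₗ[ℂ] (Fin (k + 2) → ℂ) :=
  Matrix.toLin' (Matrix.transvection (Fin.last (k + 1)) 0 τ)

theorem shear_apply_last (τ : ℂ) (Z : Fin (k + 2) → ℂ) :
    shear k τ Z (Fin.last (k + 1)) = Z (Fin.last (k + 1)) + τ * Z 0 := by
  simp [shear, Matrix.transvection, Matrix.single_mulVec]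

theorem shear_apply_of_ne (τ : ℂ) (Z : Fin (k + 2) → ℂ) {j : Fin (k + 2)}
    (hj : j ≠ Fin.last (k + 1)) : shear k τ Z j = Z j := by
  simp [shear, Matrix.transvection, Matrix.single_mulVec, hj]

theorem det_shear (τ : ℂ) : LinearMap.det (shear k τ) = 1 := by
  rw [shear, LinearMap.det_toLin', Matrix.det_transvection_of_ne _ _ Fin.last_pos.ne']

theorem shear_neg_shear (τ : ℂ) (Z : Fin (k + 2) → ℂ) : shear k (-τ) (shear k τ Z) = Z := by
  funext j
  by_cases hj : j = Fin.last (k + 1)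
  · subst hj
    rw [shear_apply_last, shear_apply_last, shear_apply_of_ne _ _ Fin.last_pos.ne]
    ring
  · rw [shear_apply_of_ne _ _ hj, shear_apply_of_ne _ _ hj]

/-- The pull-back of a polynomial under `shear`. -/
def shearPoly (τ : ℂ) (s : MvPolynomial (Fin (k + 2)) ℂ) : MvPolynomial (Fin (k + 2)) ℂ :=
  aeval (fun j => if j = Fin.last (k + 1) then X (Fin.last (k + 1)) + C τ * X 0 else X j) s

theorem eval_shearPoly (τ : ℂ) (s : MvPolynomial (Fin (k + 2)) ℂ) (Z : Fin (k + 2) → ℂ) :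
    eval Z (shearPoly τ s) = eval (shear k τ Z) s := by
  rw [shearPoly, ← coe_aeval_eq_eval, ← coe_aeval_eq_eval, RingHom.coe_coe, RingHom.coe_coe,
    comp_aeval_apply]
  congr 2
  funext j
  by_cases hj : j = Fin.last (k + 1)
  · subst hj
    simp [shear_apply_last]
  · simp [hj, shear_apply_of_ne]

theorem isHomogeneous_shearPoly {m : ℕ} {s : MvPolynomial (Fin (k + 2)) ℂ}
    (hs : s.IsHomogeneous m) (τ : ℂ) : (shearPoly τ s).IsHomogeneous m := by
  have h := hs.aeval (fun j : Fin (k + 2) => if j = Fin.last (k + 1) then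
    X (Fin.last (k + 1)) + C τ * X 0 else (X j : MvPolynomial (Fin (k + 2)) ℂ)) (n := 1) ?_
  · rwa [one_mul] at h
  · intro j
    split_ifs
    · refine (isHomogeneous_X _ _).add ?_
      simpa using (isHomogeneous_C _ τ).mul (isHomogeneous_X ℂ (0 : Fin (k + 2)))
    · exact isHomogeneous_X _ _

/-- The shear changes a monomial only by terms of higher order along `{Z₀ = 0}`. -/
theorem exists_shearPoly_monomial (τ : ℂ) (β : Fin (k + 2) →₀ ℕ) (c : ℂ) :
    ∃ q, shearPoly τ (monomial β c) = monomial β c + X 0 ^ (β 0 + 1) * q := by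
  obtain ⟨q, hq⟩ := sub_dvd_pow_sub_pow
    (X (Fin.last (k + 1)) + C τ * X 0 : MvPolynomial (Fin (k + 2)) ℂ) (X (Fin.last (k + 1)))
    (β (Fin.last (k + 1)))
  rw [add_sub_cancel_left, sub_eq_iff_eq_add] at hq
  have hprod : ∀ f : Fin (k + 2) → MvPolynomial (Fin (k + 2)) ℂ, ∏ j, f j =
      f 0 * ((∏ i : Fin k, f i.castSucc.succ) * f (Fin.last (k + 1))) := fun f => by
    rw [Fin.prod_univ_succ, Fin.prod_univ_castSucc]
    rfl
  refine ⟨C c * (∏ i : Fin k, X i.castSucc.succ ^ β i.castSucc.succ) * C τ * q, ?_⟩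
  rw [shearPoly, aeval_monomial, monomial_eq, Finsupp.prod_fintype _ _ (fun i => pow_zero _),
    Finsupp.prod_fintype _ _ (fun i => pow_zero _), hprod, hprod]
  simp only [if_true, castSucc_succ_ne_last, if_false, (Fin.last_pos (n := k)).ne, hq]
  rw [algebraMap_eq]
  ring

theorem coeff_X_zero_pow_mul {N : ℕ} {e : ℕ} {γ : Fin (N + 1) →₀ ℕ} (h : γ 0 < e)
    (q : MvPolynomial (Fin (N + 1)) ℂ) : (X 0 ^ e * q).coeff γ = 0 := by
  rw [X_pow_eq_monomial, coeff_monomial_mul', if_neg]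
  rw [Finsupp.single_le_iff]
  omega

theorem toLex_lt_of_apply_zero_lt {N : ℕ} {a b : Fin (N + 1) →₀ ℕ} (h : a 0 < b 0) :
    toLex a < toLex b :=
  Finsupp.Lex.lt_iff.2 ⟨0, fun j hj => absurd hj (Fin.not_lt_zero j), h⟩

theorem succAbove_last_zero : (Fin.last (k + 1)).succAbove 0 = 0 := by
  rw [Fin.succAbove_last]; rfl

/-- A substitution that preserves the flag preserves leading terms. -/
theorem coeff_shearPoly_of_mem_monicSections {m : ℕ} {a : Fin (k + 1) →₀ ℕ}
    {s : MvPolynomial (Fin (k + 2)) ℂ} (hs : s ∈ monicSections (k + 1) m a) (τ : ℂ) :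
    (shearPoly τ s).coeff (homExponent m a) = 1 := by
  obtain ⟨hhom, ⟨h1, h2⟩, h3⟩ := hs
  have hs' : s.IsHomogeneous m := hhom
  have ha : ∑ i, a i ≤ m := mem_orderSet_iff.1 ⟨s, hhom, h1, h2⟩
  rw [coeff_localExpr hs', if_pos ha] at h3
  have e : shearPoly τ s = ∑ β ∈ s.support, shearPoly τ (monomial β (s.coeff β)) := by
    conv_lhs => rw [s.as_sum]
    rw [shearPoly, map_sum]
    rfl
  rw [e, coeff_sum, ← h3]
  conv_rhs => rw [s.as_sum, coeff_sum]
  refine Finset.sum_congr rfl fun β hβ => ?_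
  obtain ⟨q, hq⟩ := exists_shearPoly_monomial τ β (s.coeff β)
  have hβs := sum_eq_of_isHomogeneous hs' (mem_support_iff.1 hβ)
  have hle : a 0 ≤ β 0 := by
    by_contra! hlt
    have hb := (chartExponent_eq_iff hβs (chartExponent β)).1 rfl
    have h4 : (localExpr s).coeff (chartExponent β) ≠ 0 := by
      rw [coeff_localExpr hs', if_pos hb.1, ← hb.2]
      exact mem_support_iff.1 hβ
    refine absurd (h2 _ h4) (not_le.2 (toLex_lt_of_apply_zero_lt ?_))
    rwa [chartExponent_apply, succAbove_last_zero]
  rw [hq, coeff_add, coeff_X_zero_pow_mul, add_zero]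
  have : homExponent m a 0 = a 0 := by
    conv_lhs => rw [← succAbove_last_zero, homExponent_succAbove]
  omega

theorem shearPoly_monomial_mem_monicSections {m : ℕ} {a : Fin (k + 1) →₀ ℕ}
    (ha : ∑ i, a i ≤ m) (τ : ℂ) :
    shearPoly τ (monomial (homExponent m a) 1) ∈ monicSections (k + 1) m a := by
  obtain ⟨q, hq⟩ := exists_shearPoly_monomial τ (homExponent m a) 1
  have h0 : homExponent m a 0 = a 0 := by
    conv_lhs => rw [← succAbove_last_zero, homExponent_succAbove]
  have hloc : localExpr (shearPoly τ (monomial (homExponent m a) 1)) =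
      monomial a 1 + X 0 ^ (a 0 + 1) * localExpr q := by
    have hX : localExpr (X 0 : MvPolynomial (Fin (k + 2)) ℂ) = X 0 := by
      rw [localExpr, aeval_X]
      conv_lhs => rw [← succAbove_last_zero, Fin.insertNth_apply_succAbove]
    have hm := localExpr_monomial (homExponent m a) 1
    rw [(chartExponent_eq_iff (sum_homExponent ha) a).2 ⟨ha, rfl⟩] at hm
    rw [hq, h0, ← hm, ← hX]
    simp only [localExpr, map_add, map_mul, map_pow]
  have hone : (localExpr (shearPoly τ (monomial (homExponent m a) 1))).coeff a = 1 := by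
    rw [hloc, coeff_add, coeff_monomial, if_pos rfl, coeff_X_zero_pow_mul (by omega), add_zero]
  refine ⟨isHomogeneous_shearPoly (isHomogeneous_monomial_homExponent ha 1) τ,
    ⟨by rw [hone]; exact one_ne_zero, fun b hb => ?_⟩, hone⟩
  by_cases hab : a = b
  · rw [hab]
  rw [hloc, coeff_add, coeff_monomial, if_neg hab, zero_add] at hb
  refine (toLex_lt_of_apply_zero_lt ?_).le
  by_contra! hlt
  exact hb (coeff_X_zero_pow_mul (by omega) _)

end Shear

/-! ### Chebyshev sections of the geodesic -/

section Norms

variable {k : ℕ}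

/-- The pivots of the Hermitian form `‖exp (t A / 2) Z‖²`: `1 / cosh t` for the first coordinate,
`cosh t` for the last and `1` for the others. -/
def pivot (k : ℕ) (t : ℝ) (j : Fin (k + 2)) : ℝ :=
  if j = 0 then 1 / Real.cosh t else if j = Fin.last (k + 1) then Real.cosh t else 1

theorem pivot_pos (t : ℝ) (j : Fin (k + 2)) : 0 < pivot k t j := by
  have := Real.cosh_pos t
  unfold pivot
  split_ifs <;> positivity

theorem sum_pivot (t : ℝ) (f : Fin (k + 2) → ℝ) :
    ∑ j, pivot k t j * f j = 1 / Real.cosh t * f 0 +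
      (∑ i : Fin k, f i.castSucc.succ + Real.cosh t * f (Fin.last (k + 1))) := by
  have h4 : (Fin.last k).succ = Fin.last (k + 1) := rfl
  rw [Fin.sum_univ_succ, Fin.sum_univ_castSucc]
  simp only [pivot, if_true, h4, castSucc_succ_ne_last, if_false, Fin.last_pos.ne',
    Fin.succ_ne_zero, one_mul]

/-- Completing the square: `‖exp (t A / 2) Z‖²` is diagonal in coordinates that are adapted to the
flag. -/
theorem norm_flowFrame_sq_eq_sum_pivot (t : ℝ) (Z : Fin (k + 2) → ℂ) :
    ‖flowFrame k t Z‖ ^ 2 = ∑ j, pivot k t j * ‖shear k (Real.tanh t : ℝ) Z j‖ ^ 2 := by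
  rw [sum_pivot t fun j => ‖shear k (Real.tanh t : ℝ) Z j‖ ^ 2, norm_flowFrame_sq,
    shear_apply_last, shear_apply_of_ne _ _ Fin.last_pos.ne]
  simp only [shear_apply_of_ne _ _ (castSucc_succ_ne_last _), Complex.ofReal_re]
  have hc := Real.cosh_pos t
  have hsq := Real.cosh_sq t
  have h1 : Real.exp t = Real.cosh t + Real.sinh t := (Real.cosh_add_sinh t).symm
  have h2 : Real.exp (-t) = Real.cosh t - Real.sinh t := (Real.cosh_sub_sinh t).symm
  rw [h1, h2, Real.tanh_eq_sinh_div_cosh]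
  simp only [← Complex.normSq_eq_norm_sq, Complex.normSq_apply]
  simp only [Complex.add_re, Complex.add_im, Complex.sub_re, Complex.sub_im,
    Complex.re_ofReal_mul, Complex.im_ofReal_mul]
  generalize Real.cosh t = c at *
  generalize Real.sinh t = s at *
  field_simp
  linear_combination (2 * ((Z 0).re ^ 2 + (Z 0).im ^ 2)) * hsq

theorem continuous_norm_flowFrame_sq (t : ℝ) :
    Continuous fun Z : Fin (k + 2) → ℂ => ‖flowFrame k t Z‖ ^ 2 :=
  ((contDiff_flowFrame (m := 0) contDiff_const contDiff_id).continuous).norm.pow 2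

theorem norm_flowFrame_sq_pos (t : ℝ) {Z : Fin (k + 2) → ℂ} (hZ : Z ≠ 0) :
    0 < ‖flowFrame k t Z‖ ^ 2 := by
  have : flowFrame k t Z ≠ 0 := fun h => hZ (flowFrame_eq_zero h)
  positivity

theorem norm_flowFrame_smul_sq (t : ℝ) (c : ℂ) (Z : Fin (k + 2) → ℂ) :
    ‖flowFrame k t (c • Z)‖ ^ 2 = ‖c‖ ^ 2 * ‖flowFrame k t Z‖ ^ 2 := by
  rw [flowFrame_smul, norm_smul, mul_pow]

theorem exp_neg_flowPotential (t : ℝ) (m : ℕ) {Z : Fin (k + 2) → ℂ} (hZ : Z ≠ 0) :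
    Real.exp (-(m * flowPotential k t Z)) = ((‖flowFrame k t Z‖ ^ 2) ^ m)⁻¹ := by
  rw [Real.exp_neg, mul_comm, flowPotential, Real.exp_mul,
    Real.exp_log (norm_flowFrame_sq_pos t hZ), Real.rpow_natCast]

/-- The volume form of the Fubini–Study metric at time `t`, up to a constant. -/
def flowVolume (k : ℕ) (t : ℝ) (Z : Fin (k + 2) → ℂ) : ℝ :=
  ((‖flowFrame k t Z‖ ^ 2) ^ (k + 2))⁻¹

theorem isVolumeForm_flowVolume (t : ℝ) : IsVolumeForm (n := k + 1) (flowVolume k t) where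
  smooth := by
    have h1 : ContDiff ℝ ∞ fun Z : Fin (k + 2) → ℂ => flowFrame k t Z :=
      (contDiff_flowFrame contDiff_const contDiff_id).restrict_scalars ℝ
    exact ((h1.norm_sq ℂ).pow (k + 2)).contDiffOn.inv
      fun Z hZ => pow_ne_zero _ (norm_flowFrame_sq_pos t hZ).ne'
  pos Z hZ := inv_pos.2 (pow_pos (norm_flowFrame_sq_pos t hZ) _)
  homogeneous l Z hl hZ := by
    rw [flowVolume, flowVolume, norm_flowFrame_smul_sq, mul_pow, mul_inv, ← pow_mul,
      div_eq_mul_inv, mul_comm]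

theorem hilbNormSq_flowVolume (t : ℝ) (m : ℕ) (s : MvPolynomial (Fin (k + 2)) ℂ) :
    hilbNormSq (n := k + 1) (flowPotential k t) (flowVolume k t) m s =
      ∫ z : Fin (k + 1) → ℂ, ‖MvPolynomial.eval (affinePoint (Fin.last (k + 1)) z) s‖ ^ 2 /
        (‖flowFrame k t (affinePoint (Fin.last (k + 1)) z)‖ ^ 2) ^ (m + (k + 1) + 1) := by
  refine integral_congr_ae (Filter.Eventually.of_forall fun z => ?_)
  simp only [exp_neg_flowPotential t m (affinePoint_ne_zero _ z), flowVolume]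
  rw [mul_assoc, ← mul_inv, ← pow_add, div_eq_mul_inv]
  rfl

/-- The shear has determinant `1` and diagonalizes the weight. -/
theorem integral_gauss_eq (t : ℝ) (s : MvPolynomial (Fin (k + 2)) ℂ) :
    ∫ Z, ‖MvPolynomial.eval Z s‖ ^ 2 * Real.exp (-‖flowFrame k t Z‖ ^ 2) =
      ∫ W, ‖MvPolynomial.eval W (shearPoly (-(Real.tanh t : ℝ)) s)‖ ^ 2 *
        gaussWeight (pivot k t) W := by
  have hmp := measurePreserving_linear (shear k (Real.tanh t : ℝ)) (det_shear _)
  have hcont : Continuous fun W : Fin (k + 2) → ℂ =>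
      ‖MvPolynomial.eval W (shearPoly (-(Real.tanh t : ℝ)) s)‖ ^ 2 * gaussWeight (pivot k t) W :=
    ((MvPolynomial.continuous_eval _).norm.pow 2).mul continuous_gaussWeight
  have h := integral_map hmp.measurable.aemeasurable
    (hcont.aestronglyMeasurable (μ := volume.map (shear k (Real.tanh t : ℝ))))
  rw [hmp.map_eq] at h
  rw [h]
  refine integral_congr_ae (Filter.Eventually.of_forall fun Z => ?_)
  simp only [eval_shearPoly, shear_neg_shear, gaussWeight, norm_flowFrame_sq_eq_sum_pivot]

/-- The squared norm of the Chebyshev section with leading exponent `a` for the volume form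
`flowVolume`. -/
def chebyshevNormSq (k : ℕ) (t : ℝ) (m : ℕ) (a : Fin (k + 1) →₀ ℕ) : ℝ :=
  gaussMonomialNormSq (pivot k t) (homExponent m a) / (Real.pi * (m + (k + 1)).factorial)

theorem chebyshevNormSq_pos (t : ℝ) (m : ℕ) (a : Fin (k + 1) →₀ ℕ) :
    0 < chebyshevNormSq k t m a :=
  div_pos (gaussMonomialNormSq_pos (pivot_pos t) _) (by positivity)

theorem hilbNormSq_eq (t : ℝ) {m : ℕ} {s : MvPolynomial (Fin (k + 2)) ℂ}
    (hs : s.IsHomogeneous m) :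
    hilbNormSq (n := k + 1) (flowPotential k t) (flowVolume k t) m s =
      (∫ W, ‖MvPolynomial.eval W (shearPoly (-(Real.tanh t : ℝ)) s)‖ ^ 2 *
        gaussWeight (pivot k t) W) / (Real.pi * (m + (k + 1)).factorial) := by
  rw [← integral_gauss_eq, integral_eval_affinePoint (continuous_norm_flowFrame_sq t)
    (fun Z hZ => norm_flowFrame_sq_pos t hZ) (norm_flowFrame_smul_sq t) hs,
    hilbNormSq_flowVolume, mul_div_cancel_left₀]
  positivity

theorem chebyshevNormSq_le (t : ℝ) {m : ℕ} {a : Fin (k + 1) →₀ ℕ}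
    {s : MvPolynomial (Fin (k + 2)) ℂ} (hs : s ∈ monicSections (k + 1) m a) :
    chebyshevNormSq k t m a ≤
      hilbNormSq (n := k + 1) (flowPotential k t) (flowVolume k t) m s := by
  rw [hilbNormSq_eq t hs.1, chebyshevNormSq]
  gcongr
  exact gaussMonomialNormSq_le (pivot_pos t) (coeff_shearPoly_of_mem_monicSections hs _)

/-- The Chebyshev section for the volume form `flowVolume`: a monomial in the sheared coordinates.
-/
def flowSection (k : ℕ) (t : ℝ) (m : ℕ) (a : Fin (k + 1) →₀ ℕ) : MvPolynomial (Fin (k + 2)) ℂ :=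
  shearPoly (Real.tanh t : ℝ) (MvPolynomial.monomial (homExponent m a) 1)

theorem flowSection_mem (t : ℝ) {m : ℕ} {a : Fin (k + 1) →₀ ℕ} (ha : ∑ i, a i ≤ m) :
    flowSection k t m a ∈ monicSections (k + 1) m a :=
  shearPoly_monomial_mem_monicSections ha _

theorem hilbNormSq_flowSection (t : ℝ) {m : ℕ} {a : Fin (k + 1) →₀ ℕ} (ha : ∑ i, a i ≤ m) :
    hilbNormSq (n := k + 1) (flowPotential k t) (flowVolume k t) m (flowSection k t m a) =
      chebyshevNormSq k t m a := by
  rw [hilbNormSq_eq t (flowSection_mem t ha).1, chebyshevNormSq,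
    ← integral_norm_monomial_sq (pivot_pos t)]
  congr 2
  funext W
  have := shear_neg_shear (k := k) (-(Real.tanh t : ℝ)) W
  rw [neg_neg] at this
  rw [eval_shearPoly, flowSection, eval_shearPoly, this, MvPolynomial.eval_monomial, one_mul,
    Finsupp.prod_fintype _ _ (fun i => pow_zero _)]

theorem isChebyshevSection_flowSection (t : ℝ) {m : ℕ} {a : Fin (k + 1) →₀ ℕ}
    (ha : ∑ i, a i ≤ m) :
    IsChebyshevSection (n := k + 1) (flowPotential k t) (flowVolume k t) m a
      (flowSection k t m a) :=
  ⟨flowSection_mem t ha, fun _ hs' =>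
    (hilbNormSq_flowSection t ha).trans_le (chebyshevNormSq_le t hs')⟩

/-- Two volume forms differ by a bounded factor, as the unit sphere is compact. -/
theorem exists_volume_bounds (t : ℝ) {ρ : (Fin (k + 2) → ℂ) → ℝ}
    (hρ : IsVolumeForm (n := k + 1) ρ) :
    ∃ C₁ C₂ : ℝ, 0 < C₁ ∧ 0 < C₂ ∧ ∀ Z, Z ≠ 0 →
      C₁ * flowVolume k t Z ≤ ρ Z ∧ ρ Z ≤ C₂ * flowVolume k t Z := by
  have hv := isVolumeForm_flowVolume (k := k) t
  set S := Metric.sphere (0 : Fin (k + 2) → ℂ) 1 with hS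
  have hne : ∀ Z ∈ S, Z ≠ 0 := fun Z hZ => ne_zero_of_mem_unit_sphere ⟨Z, hZ⟩
  have hcont : ContinuousOn (fun Z => ρ Z / flowVolume k t Z) S :=
    (hρ.smooth.continuousOn.mono hne).div (hv.smooth.continuousOn.mono hne)
      fun Z hZ => (hv.pos Z (hne Z hZ)).ne'
  have hcpt : IsCompact S := isCompact_sphere _ _
  have hnonempty : S.Nonempty := NormedSpace.sphere_nonempty.2 zero_le_one
  obtain ⟨Z₁, hZ₁, h₁⟩ := hcpt.exists_isMinOn hnonempty hcont
  obtain ⟨Z₂, hZ₂, h₂⟩ := hcpt.exists_isMaxOn hnonempty hcont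
  refine ⟨_, _, div_pos (hρ.pos _ (hne _ hZ₁)) (hv.pos _ (hne _ hZ₁)),
    div_pos (hρ.pos _ (hne _ hZ₂)) (hv.pos _ (hne _ hZ₂)), fun Z hZ => ?_⟩
  have hn : (‖Z‖ : ℂ)⁻¹ ≠ 0 := by simpa using hZ
  have hmem : (‖Z‖ : ℂ)⁻¹ • Z ∈ S := by
    rw [hS, mem_sphere_zero_iff_norm, norm_smul, norm_inv, Complex.norm_real, norm_norm,
      inv_mul_cancel₀ (norm_ne_zero_iff.2 hZ)]
  have hr : ρ ((‖Z‖ : ℂ)⁻¹ • Z) / flowVolume k t ((‖Z‖ : ℂ)⁻¹ • Z) = ρ Z / flowVolume k t Z := by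
    rw [hρ.homogeneous _ _ hn hZ, hv.homogeneous _ _ hn hZ, div_div_div_cancel_right₀]
    positivity
  have b1 := h₁ hmem
  have b2 := h₂ hmem
  simp only [Set.mem_ofPred_eq, hr] at b1 b2
  exact ⟨(le_div_iff₀ (hv.pos Z hZ)).1 b1, (div_le_iff₀ (hv.pos Z hZ)).1 b2⟩

/-- The Chebyshev norm for an arbitrary volume form differs from `chebyshevNormSq` by a factor
that is bounded uniformly in `m` and `a`. -/
theorem exists_hilbNormSq_bounds (t : ℝ) {ρ : (Fin (k + 2) → ℂ) → ℝ}
    (hρ : IsVolumeForm (n := k + 1) ρ) :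
    ∃ C₁ C₂ : ℝ, 0 < C₁ ∧ 0 < C₂ ∧ ∀ (m : ℕ) (a : Fin (k + 1) →₀ ℕ)
      (s : MvPolynomial (Fin (k + 2)) ℂ),
      IsChebyshevSection (n := k + 1) (flowPotential k t) ρ m a s →
      C₁ * chebyshevNormSq k t m a ≤ hilbNormSq (n := k + 1) (flowPotential k t) ρ m s ∧
      hilbNormSq (n := k + 1) (flowPotential k t) ρ m s ≤ C₂ * chebyshevNormSq k t m a := by
  obtain ⟨C₁, C₂, h₁, h₂, hC⟩ := exists_volume_bounds t hρ
  refine ⟨C₁, C₂, h₁, h₂, fun m a s hs => ?_⟩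
  have ha : ∑ i, a i ≤ m := mem_orderSet_iff.1 ⟨s, hs.1.1, hs.1.2.1⟩
  have hv := isVolumeForm_flowVolume (k := k) t
  set A := affinePoint (n := k + 1) (Fin.last (k + 1)) with hA
  have hAne : ∀ z, A z ≠ 0 := affinePoint_ne_zero _
  have hAc : Continuous A := (contDiff_affinePoint _).continuous
  have hcontOn : ∀ {u : (Fin (k + 2) → ℂ) → ℝ}, ContDiffOn ℝ ∞ u {0}ᶜ →
      Continuous fun z => u (A z) := fun hu =>
    hu.continuousOn.comp_continuous hAc fun z => hAne z
  have hcont : ∀ {r : (Fin (k + 2) → ℂ) → ℝ}, IsVolumeForm (n := k + 1) r →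
      ∀ s : MvPolynomial (Fin (k + 2)) ℂ, Continuous fun z : Fin (k + 1) → ℂ =>
      ‖MvPolynomial.eval (A z) s‖ ^ 2 * Real.exp (-(m * flowPotential k t (A z))) * r (A z) :=
    fun hr s => ((((MvPolynomial.continuous_eval s).comp hAc).norm.pow 2).mul
      (continuous_const.mul (hcontOn (contDiffOn_flowPotential_apply t))).neg.rexp).mul
      (hcontOn hr.smooth)
  -- a function with non-zero integral is integrable
  have hint₀ : ∀ s' ∈ monicSections (k + 1) m a, Integrable fun z : Fin (k + 1) → ℂ =>
      ‖MvPolynomial.eval (A z) s'‖ ^ 2 * Real.exp (-(m * flowPotential k t (A z))) *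
        flowVolume k t (A z) := fun s' hs' =>
    Integrable.of_integral_ne_zero
      ((chebyshevNormSq_pos t m a).trans_le (chebyshevNormSq_le t hs')).ne'
  have hle₂ : ∀ (s' : MvPolynomial (Fin (k + 2)) ℂ) (z : Fin (k + 1) → ℂ),
      ‖MvPolynomial.eval (A z) s'‖ ^ 2 * Real.exp (-(m * flowPotential k t (A z))) * ρ (A z) ≤
      C₂ * (‖MvPolynomial.eval (A z) s'‖ ^ 2 * Real.exp (-(m * flowPotential k t (A z))) *
        flowVolume k t (A z)) := fun s' z => by
    rw [mul_left_comm]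
    exact mul_le_mul_of_nonneg_left (hC _ (hAne z)).2 (by positivity)
  have hle₁ : ∀ (s' : MvPolynomial (Fin (k + 2)) ℂ) (z : Fin (k + 1) → ℂ),
      C₁ * (‖MvPolynomial.eval (A z) s'‖ ^ 2 * Real.exp (-(m * flowPotential k t (A z))) *
        flowVolume k t (A z)) ≤
      ‖MvPolynomial.eval (A z) s'‖ ^ 2 * Real.exp (-(m * flowPotential k t (A z))) * ρ (A z) :=
    fun s' z => by
    rw [mul_left_comm]
    exact mul_le_mul_of_nonneg_left (hC _ (hAne z)).1 (by positivity)
  have hint : ∀ s' ∈ monicSections (k + 1) m a, Integrable fun z : Fin (k + 1) → ℂ =>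
      ‖MvPolynomial.eval (A z) s'‖ ^ 2 * Real.exp (-(m * flowPotential k t (A z))) *
        ρ (A z) := fun s' hs' =>
    ((hint₀ s' hs').const_mul C₂).mono' (hcont hρ s').aestronglyMeasurable
      (Filter.Eventually.of_forall fun z => by
        rw [Real.norm_of_nonneg (mul_nonneg (by positivity) (hρ.pos _ (hAne z)).le)]
        exact hle₂ s' z)
  constructor
  · calc C₁ * chebyshevNormSq k t m a
        ≤ C₁ * hilbNormSq (n := k + 1) (flowPotential k t) (flowVolume k t) m s := by
          gcongr
          exact chebyshevNormSq_le t hs.1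
      _ ≤ _ := by
          rw [hilbNormSq, ← integral_const_mul]
          exact integral_mono ((hint₀ s hs.1).const_mul C₁) (hint s hs.1) (hle₁ s)
  · have hmem := flowSection_mem (k := k) t ha
    calc hilbNormSq (n := k + 1) (flowPotential k t) ρ m s
        ≤ hilbNormSq (n := k + 1) (flowPotential k t) ρ m (flowSection k t m a) := hs.2 _ hmem
      _ ≤ C₂ * hilbNormSq (n := k + 1) (flowPotential k t) (flowVolume k t) m
            (flowSection k t m a) := by
          rw [hilbNormSq, hilbNormSq, ← integral_const_mul]
          exact integral_mono (hint _ hmem) ((hint₀ _ hmem).const_mul C₂) (hle₂ _)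
      _ = _ := by rw [hilbNormSq_flowSection t ha]

end Norms

open Filter

/-! ### Asymptotics of Gaussian norms -/

section Asymptotics

theorem log_factorial_bounds (e : ℕ) :
    0 ≤ Real.log e.factorial - (e * Real.log e - e) ∧
      Real.log e.factorial - (e * Real.log e - e) ≤ 2 * √(e + 1) := by
  rcases Nat.eq_zero_or_pos e with rfl | he
  · simp
  have he' : (1 : ℝ) ≤ e := by exact_mod_cast he
  have hlog : 0 ≤ Real.log e := Real.log_nonneg he'
  constructor
  · have h := Stirling.le_log_factorial_stirling he.ne'
    have : 0 ≤ Real.log (2 * Real.pi) := Real.log_nonneg (by linarith [Real.pi_gt_three])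
    linarith
  · have h1 : Real.log (Stirling.stirlingSeq e) ≤ Real.log (Stirling.stirlingSeq 1) := by
      obtain ⟨e', rfl⟩ := Nat.exists_eq_succ_of_ne_zero he.ne'
      exact Stirling.log_stirlingSeq'_antitone (Nat.zero_le e')
    rw [Stirling.log_stirlingSeq_formula, Stirling.log_stirlingSeq_formula] at h1
    simp only [Nat.factorial_one, Nat.cast_one, Real.log_one, mul_one, one_mul] at h1
    rw [Real.log_div (by positivity) (Real.exp_pos 1).ne', Real.log_exp,
      Real.log_div one_ne_zero (Real.exp_pos 1).ne', Real.log_exp, Real.log_one,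
      Real.log_mul two_ne_zero (by positivity)] at h1
    have h2 : Real.log e / 2 ≤ √e - 1 := by
      have := Real.log_le_sub_one_of_pos (Real.sqrt_pos.2 (by linarith : (0 : ℝ) < e))
      rwa [Real.log_sqrt (by positivity)] at this
    have h3 : √(e : ℝ) ≤ √(e + 1) := Real.sqrt_le_sqrt (by linarith)
    have h4 : 1 ≤ √(e : ℝ) := Real.one_le_sqrt.2 he'
    linarith

variable {m : ℕ → ℕ}

/-- Stirling's formula on the scale of `m`; the exponents `e` need not tend to infinity. -/
theorem tendsto_log_factorial_div {e : ℕ → ℕ} {α : ℝ} (hm : Tendsto m atTop atTop)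
    (he : Tendsto (fun k => (e k : ℝ) / m k) atTop (𝓝 α)) :
    Tendsto (fun k => 1 / (m k : ℝ) *
      (Real.log (e k).factorial - (e k * Real.log (m k) - e k))) atTop (𝓝 (α * Real.log α)) := by
  have hinv : Tendsto (fun k => 1 / (m k : ℝ)) atTop (𝓝 0) :=
    tendsto_one_div_atTop_nhds_zero_nat.comp hm
  have hbound : Tendsto (fun k => 2 * √((e k / m k + 1 / (m k : ℝ)) * (1 / (m k : ℝ))))
      atTop (𝓝 0) := by
    have h := ((he.add hinv).mul hinv)
    have h2 := ((Real.continuous_sqrt.tendsto _).comp h).const_mul 2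
    simpa using h2
  have hrem : Tendsto (fun k => 1 / (m k : ℝ) *
      (Real.log (e k).factorial - (e k * Real.log (e k) - e k))) atTop (𝓝 0) := by
    refine squeeze_zero (fun k => mul_nonneg (by positivity) (log_factorial_bounds (e k)).1)
      (fun k => ?_) hbound
    have e1 : ((e k : ℝ) / m k + 1 / (m k : ℝ)) * (1 / (m k : ℝ)) =
        (1 / (m k : ℝ)) ^ 2 * (e k + 1) := by ring
    rw [e1, Real.sqrt_mul (by positivity), Real.sqrt_sq (by positivity), mul_left_comm]
    exact mul_le_mul_of_nonneg_left (log_factorial_bounds (e k)).2 (by positivity)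
  have hmain : Tendsto (fun k => (e k : ℝ) / m k * Real.log ((e k : ℝ) / m k)) atTop
      (𝓝 (α * Real.log α)) := (Real.continuous_mul_log.tendsto α).comp he
  have hsum := hmain.add hrem
  rw [add_zero] at hsum
  refine hsum.congr' ?_
  filter_upwards [hm.eventually_gt_atTop 0] with k hk
  have hk' : (m k : ℝ) ≠ 0 := by exact_mod_cast hk.ne'
  rcases Nat.eq_zero_or_pos (e k) with h0 | h0
  · simp [h0]
  · have h0' : (e k : ℝ) ≠ 0 := by exact_mod_cast h0.ne'
    rw [Real.log_div h0' hk']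
    ring

theorem tendsto_log_div_nat (hm : Tendsto m atTop atTop) :
    Tendsto (fun k => 1 / (m k : ℝ) * Real.log (m k)) atTop (𝓝 0) := by
  have h : Tendsto (fun x : ℝ => Real.log x / x) atTop (𝓝 0) :=
    Real.isLittleO_log_id_atTop.tendsto_div_nhds_zero
  have := (h.comp tendsto_natCast_atTop_atTop).comp hm
  refine this.congr fun k => ?_
  simp only [Function.comp_apply]
  ring

/-- The exponential growth rate of the norms of monomials. In the factorials, the terms with
`log m` cancel because `∑ⱼ γⱼ = m`. -/
theorem tendsto_log_gaussMonomialNormSq {N n : ℕ} {d : Fin N → ℝ} (hd : ∀ j, 0 < d j)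
    (hm : Tendsto m atTop atTop) {γ : ℕ → Fin N →₀ ℕ} (hsum : ∀ k, ∑ j, γ k j = m k)
    {α : Fin N → ℝ} (hα : ∀ j, Tendsto (fun k => (γ k j : ℝ) / m k) atTop (𝓝 (α j))) :
    Tendsto (fun k => 1 / (m k : ℝ) * Real.log
      (gaussMonomialNormSq d (γ k) / (Real.pi * (m k + n).factorial))) atTop
      (𝓝 (∑ j, (α j * Real.log (α j) - α j * Real.log (d j)))) := by
  have hinv : Tendsto (fun k => 1 / (m k : ℝ)) atTop (𝓝 0) :=
    tendsto_one_div_atTop_nhds_zero_nat.comp hm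
  have hlog := tendsto_log_div_nat hm
  have hmn : Tendsto (fun k => ((m k + n : ℕ) : ℝ) / m k) atTop (𝓝 1) := by
    have h := (hinv.const_mul (n : ℝ)).const_add 1
    rw [mul_zero, add_zero] at h
    refine h.congr' ?_
    filter_upwards [hm.eventually_gt_atTop 0] with k hk
    have hk' : (m k : ℝ) ≠ 0 := by exact_mod_cast hk.ne'
    push_cast
    field_simp
  have h1 := tendsto_finsetSum Finset.univ fun j _ =>
    (tendsto_log_factorial_div hm (hα j)).sub ((hα j).mul_const (Real.log (d j)))
  have h2 := tendsto_log_factorial_div hm hmn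
  have h3 := hinv.const_mul
    (∑ j : Fin N, (Real.log Real.pi - Real.log (d j)) - Real.log Real.pi + n)
  have h4 := hlog.const_mul (n : ℝ)
  have h5 := ((h1.sub h2).add h3).sub h4
  simp only [Real.log_one, mul_zero, sub_zero, add_zero] at h5
  refine h5.congr' ?_
  filter_upwards [hm.eventually_gt_atTop 0] with k hk
  have hk' : (m k : ℝ) ≠ 0 := by exact_mod_cast hk.ne'
  have hpi := Real.pi_pos
  have hG : Real.log (gaussMonomialNormSq d (γ k)) = ∑ j, (Real.log Real.pi +
      Real.log (γ k j).factorial - (γ k j + 1) * Real.log (d j)) := by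
    rw [gaussMonomialNormSq, Real.log_prod]
    · refine Finset.sum_congr rfl fun j _ => ?_
      have := hd j
      rw [Real.log_div (by positivity) (by positivity), Real.log_mul (by positivity)
        (by positivity), Real.log_pow]
      push_cast
      ring
    · intro j _
      have := hd j
      positivity
  have hs : (m k : ℝ) = ∑ j, (γ k j : ℝ) := by rw [← hsum k]; push_cast; rfl
  rw [Real.log_div (gaussMonomialNormSq_pos hd _).ne' (by positivity),
    Real.log_mul (by positivity) (by positivity), hG]
  have e1 : ∑ j, (1 / (m k : ℝ) * (Real.log (γ k j).factorial -
      (γ k j * Real.log (m k) - γ k j)) - (γ k j : ℝ) / m k * Real.log (d j)) =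
      1 / (m k : ℝ) * (∑ j, Real.log (γ k j).factorial - (m k : ℝ) * Real.log (m k) + m k -
        ∑ j, γ k j * Real.log (d j)) := by
    have h6 : (m k : ℝ) * Real.log (m k) - m k =
        ∑ j, ((γ k j : ℝ) * Real.log (m k) - γ k j) := by
      rw [Finset.sum_sub_distrib, ← Finset.sum_mul, ← hs]
    rw [sub_add, h6, ← Finset.sum_sub_distrib, ← Finset.sum_sub_distrib, Finset.mul_sum]
    exact Finset.sum_congr rfl fun j _ => by ring
  have e2 : ∑ j, (Real.log Real.pi + Real.log (γ k j).factorial -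
      (γ k j + 1) * Real.log (d j)) = ∑ j, (Real.log Real.pi - Real.log (d j)) +
      ∑ j, Real.log (γ k j).factorial - ∑ j, γ k j * Real.log (d j) := by
    rw [← Finset.sum_add_distrib, ← Finset.sum_sub_distrib]
    exact Finset.sum_congr rfl fun j _ => by ring
  rw [e1, e2]
  push_cast
  ring

end Asymptotics

/-! ### The Okounkov body -/

section Okounkov

variable {n : ℕ}

/-- The simplex `{α | 0 ≤ αᵢ, ∑ᵢ αᵢ ≤ 1}`. -/
def solidSimplex (n : ℕ) : Set (Fin n → ℝ) := {α | (∀ i, 0 ≤ α i) ∧ ∑ i, α i ≤ 1}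

/-- The lattice points `⌊m α⌋`, which approximate a point `α` of the simplex. -/
def floorExponent (α : Fin n → ℝ) (m : ℕ) : Fin n →₀ ℕ :=
  Finsupp.equivFunOnFinite.symm fun i => ⌊α i * m⌋₊

theorem sum_floorExponent_le {α : Fin n → ℝ} (hα : α ∈ solidSimplex n) (m : ℕ) :
    ∑ i, floorExponent α m i ≤ m := by
  have h : (∑ i, (⌊α i * m⌋₊ : ℝ)) ≤ m := by
    calc (∑ i, (⌊α i * m⌋₊ : ℝ)) ≤ ∑ i, α i * m :=
          Finset.sum_le_sum fun i _ => Nat.floor_le (mul_nonneg (hα.1 i) m.cast_nonneg)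
      _ = (∑ i, α i) * m := by rw [Finset.sum_mul]
      _ ≤ 1 * m := by gcongr; exact hα.2
      _ = m := one_mul _
  simp only [floorExponent, Finsupp.equivFunOnFinite_symm_apply_apply]
  exact_mod_cast h

theorem tendsto_floorExponent {α : Fin n → ℝ} (hα : α ∈ solidSimplex n) :
    Tendsto (fun k : ℕ => (fun i => (floorExponent α (k + 1) i : ℝ) / ((k + 1 : ℕ) : ℝ) :
      Fin n → ℝ)) atTop (𝓝 α) := by
  refine tendsto_pi_nhds.2 fun i => ?_
  have h := (tendsto_nat_floor_mul_div_atTop (hα.1 i)).comp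
    (tendsto_natCast_atTop_atTop (R := ℝ))
  exact h.comp (tendsto_add_atTop_nat 1)

theorem solidSimplex_subset_okounkovBody : solidSimplex n ⊆ okounkovBody n := fun _ hα =>
  mem_closure_of_tendsto (tendsto_floorExponent hα) (Eventually.of_forall fun k =>
    ⟨k + 1, Nat.succ_pos k, _, mem_orderSet_iff.2 (sum_floorExponent_le hα (k + 1)), rfl⟩)

theorem okounkovBody_eq_solidSimplex : okounkovBody n = solidSimplex n := by
  refine Set.Subset.antisymm (closure_minimal ?_ ?_) solidSimplex_subset_okounkovBody
  · rintro _ ⟨m, hm, a, ha, rfl⟩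
    refine ⟨fun i => by positivity, ?_⟩
    rw [← Finset.sum_div, div_le_one (by exact_mod_cast hm)]
    exact_mod_cast mem_orderSet_iff.1 ha
  · have h1 : IsClosed {α : Fin n → ℝ | ∀ i, 0 ≤ α i} := by
      simp only [Set.ofPred_forall]
      exact isClosed_iInter fun i => isClosed_le continuous_const (continuous_apply i)
    exact h1.inter (isClosed_le (continuous_finsetSum _ fun i _ => continuous_apply i)
      continuous_const)

theorem mem_interior_okounkovBody {α : Fin n → ℝ} (h : ∀ i, 0 < α i) (hs : ∑ i, α i < 1) :
    α ∈ interior (okounkovBody n) := by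
  have hopen : IsOpen {β : Fin n → ℝ | (∀ i, 0 < β i) ∧ ∑ i, β i < 1} := by
    have h1 : IsOpen {β : Fin n → ℝ | ∀ i, 0 < β i} := by
      simp only [Set.ofPred_forall]
      exact isOpen_iInter_of_finite fun i => isOpen_lt continuous_const (continuous_apply i)
    exact h1.inter (isOpen_lt (continuous_finsetSum _ fun i _ => continuous_apply i)
      continuous_const)
  refine mem_interior.2 ⟨_, fun β hβ => ?_, hopen, ⟨h, hs⟩⟩
  exact solidSimplex_subset_okounkovBody ⟨fun i => (hβ.1 i).le, hβ.2.le⟩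

end Okounkov

/-! ### Chebyshev potentials of the geodesic -/

section Chebyshev

variable {k : ℕ}

/-- The barycentric coordinates `(α₀, …, αₙ₋₁, 1 - ∑ᵢ αᵢ)`. -/
def barycentric {n : ℕ} (α : Fin n → ℝ) : Fin (n + 1) → ℝ :=
  Fin.insertNth (α := fun _ => ℝ) (Fin.last n) (1 - ∑ i, α i) α

/-- The value `∑ⱼ (αⱼ log αⱼ - αⱼ log μⱼ)` of the Chebyshev potential at time `t`, where the `αⱼ`
are barycentric coordinates and the `μⱼ` are the pivots. -/
def chebyshevValue (k : ℕ) (t : ℝ) (α : Fin (k + 1) → ℝ) : ℝ :=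
  ∑ j, (barycentric α j * Real.log (barycentric α j) -
    barycentric α j * Real.log (pivot k t j))

theorem tendsto_homExponent_div {n : ℕ} {m : ℕ → ℕ} (hm : ∀ l, 0 < m l) {a : ℕ → Fin n →₀ ℕ}
    (ha : ∀ l, ∑ i, a l i ≤ m l) {α : Fin n → ℝ}
    (hα : Tendsto (fun l => (fun i => (a l i : ℝ) / m l : Fin n → ℝ)) atTop (𝓝 α))
    (j : Fin (n + 1)) :
    Tendsto (fun l => (homExponent (m l) (a l) j : ℝ) / m l) atTop (𝓝 (barycentric α j)) := by
  have hα' := tendsto_pi_nhds.1 hα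
  refine Fin.succAboveCases (Fin.last n) ?_ (fun i => ?_) j
  · have h := (tendsto_finsetSum Finset.univ fun i _ => hα' i).const_sub 1
    rw [barycentric, Fin.insertNth_apply_same]
    refine h.congr fun l => ?_
    have hl : (m l : ℝ) ≠ 0 := by exact_mod_cast (hm l).ne'
    rw [homExponent_last, Nat.cast_sub (ha l), ← Finset.sum_div, sub_div, div_self hl]
    push_cast
    rfl
  · rw [barycentric, Fin.insertNth_apply_succAbove]
    simpa only [homExponent_succAbove] using hα' i

theorem tendsto_log_chebyshevNormSq (t : ℝ) {m : ℕ → ℕ} (hm : StrictMono m)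
    (hm0 : ∀ l, 0 < m l) {a : ℕ → Fin (k + 1) →₀ ℕ} (ha : ∀ l, ∑ i, a l i ≤ m l)
    {α : Fin (k + 1) → ℝ}
    (hα : Tendsto (fun l => (fun i => (a l i : ℝ) / m l : Fin (k + 1) → ℝ)) atTop (𝓝 α)) :
    Tendsto (fun l => 1 / (m l : ℝ) * Real.log (chebyshevNormSq k t (m l) (a l))) atTop
      (𝓝 (chebyshevValue k t α)) :=
  tendsto_log_gaussMonomialNormSq (pivot_pos t) hm.tendsto_atTop
    (fun l => sum_homExponent (ha l)) (tendsto_homExponent_div hm0 ha hα)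

theorem isChebyshevLimit_flowPotential (t : ℝ) (α : Fin (k + 1) → ℝ) :
    IsChebyshevLimit (n := k + 1) (flowPotential k t) α (chebyshevValue k t α) := by
  intro ρ hρ m hm hm0 a ha hα s hs
  obtain ⟨C₁, C₂, h₁, h₂, hC⟩ := exists_hilbNormSq_bounds t hρ
  have hlim := tendsto_log_chebyshevNormSq (k := k) t hm hm0
    (fun l => mem_orderSet_iff.1 (ha l)) hα
  have hinv : Tendsto (fun l => 1 / (m l : ℝ)) atTop (𝓝 0) :=
    tendsto_one_div_atTop_nhds_zero_nat.comp hm.tendsto_atTop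
  have hconst : ∀ C : ℝ, Tendsto (fun l => 1 / (m l : ℝ) * Real.log C +
      1 / (m l : ℝ) * Real.log (chebyshevNormSq k t (m l) (a l))) atTop
      (𝓝 (chebyshevValue k t α)) := fun C => by
    simpa using (hinv.mul_const (Real.log C)).add hlim
  refine tendsto_of_tendsto_of_tendsto_of_le_of_le (hconst C₁) (hconst C₂) (fun l => ?_)
    (fun l => ?_)
  · have hp := chebyshevNormSq_pos (k := k) t (m l) (a l)
    simp only
    rw [← mul_add, ← Real.log_mul h₁.ne' hp.ne']
    exact mul_le_mul_of_nonneg_left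
      (Real.log_le_log (by positivity) (hC _ _ _ (hs l)).1) (by positivity)
  · have hp := chebyshevNormSq_pos (k := k) t (m l) (a l)
    simp only
    rw [← mul_add, ← Real.log_mul h₂.ne' hp.ne']
    exact mul_le_mul_of_nonneg_left (Real.log_le_log
      ((mul_pos h₁ hp).trans_le (hC _ _ _ (hs l)).1) (hC _ _ _ (hs l)).2) (by positivity)

/-- The limit is determined, since every point of the Okounkov body is approached by the exponents
`⌊m α⌋`, and explicit Chebyshev sections exist for the volume form `flowVolume`. -/
theorem chebyshevPotential_flowPotential (t : ℝ) {α : Fin (k + 1) → ℝ}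
    (hα : α ∈ interior (okounkovBody (k + 1))) :
    chebyshevPotential (n := k + 1) (flowPotential k t) α = chebyshevValue k t α := by
  have hex : ∃ c, IsChebyshevLimit (n := k + 1) (flowPotential k t) α c :=
    ⟨_, isChebyshevLimit_flowPotential t α⟩
  have hα' : α ∈ solidSimplex (k + 1) := by
    rw [← okounkovBody_eq_solidSimplex]
    exact interior_subset hα
  have hunique : ∀ c, IsChebyshevLimit (n := k + 1) (flowPotential k t) α c →
      c = chebyshevValue k t α := fun c hc => by
    have hm : StrictMono fun l : ℕ => l + 1 := fun _ _ h => Nat.succ_lt_succ h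
    have hle := fun l : ℕ => sum_floorExponent_le hα' (l + 1)
    have h := hc _ (isVolumeForm_flowVolume t) _ hm (fun l => Nat.succ_pos l)
      (fun l => floorExponent α (l + 1)) (fun l => mem_orderSet_iff.2 (hle l))
      (tendsto_floorExponent hα') _ fun l => isChebyshevSection_flowSection t (hle l)
    have h' := isChebyshevLimit_flowPotential t α _ (isVolumeForm_flowVolume t) _ hm
      (fun l => Nat.succ_pos l)
      (fun l => floorExponent α (l + 1)) (fun l => mem_orderSet_iff.2 (hle l))
      (tendsto_floorExponent hα') _ fun l => isChebyshevSection_flowSection t (hle l)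
    exact tendsto_nhds_unique h h'
  rw [chebyshevPotential, dif_pos hex]
  exact hunique _ hex.choose_spec

theorem chebyshevExists_flowPotential (a b : ℝ) :
    ChebyshevExists (n := k + 1) a b (flowPotential k) := fun t _ α hα => by
  rw [chebyshevPotential_flowPotential t hα]
  exact isChebyshevLimit_flowPotential t α

theorem chebyshevValue_eq (t : ℝ) (α : Fin (k + 1) → ℝ) :
    chebyshevValue k t α = ∑ j, barycentric α j * Real.log (barycentric α j) +
      (α 0 - (1 - ∑ i, α i)) * Real.log (Real.cosh t) := by
  have h0 : barycentric α 0 = α 0 := by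
    rw [barycentric, ← succAbove_last_zero, Fin.insertNth_apply_succAbove]
  have hl : barycentric α (Fin.last (k + 1)) = 1 - ∑ i, α i := by
    rw [barycentric, Fin.insertNth_apply_same]
  have h4 : (Fin.last k).succ = Fin.last (k + 1) := rfl
  have hs : ∑ j, barycentric α j * Real.log (pivot k t j) =
      -((α 0 - (1 - ∑ i, α i)) * Real.log (Real.cosh t)) := by
    rw [Fin.sum_univ_succ, Fin.sum_univ_castSucc]
    simp only [pivot, h4, castSucc_succ_ne_last, Fin.succ_ne_zero, Fin.last_pos.ne', if_true,
      if_false,       Real.log_one, mul_zero, Finset.sum_const_zero, h0, hl, one_div, Real.log_inv]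
    ring
  rw [chebyshevValue, Finset.sum_sub_distrib, hs, sub_neg_eq_add]

theorem not_affine_log_cosh {a b : ℝ} (hab : a < b) {A B C : ℝ} (hC : C ≠ 0) :
    ¬ ∀ t ∈ Set.Icc a b, C * Real.log (Real.cosh t) = A + t * B := by
  intro h
  have ha := h a ⟨le_rfl, hab.le⟩
  have hb := h b ⟨hab.le, le_rfl⟩
  have hm := h ((a + b) / 2) ⟨by linarith, by linarith⟩
  have e : 2 * Real.log (Real.cosh ((a + b) / 2)) =
      Real.log (Real.cosh a) + Real.log (Real.cosh b) := by
    apply mul_left_cancel₀ hC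
    linear_combination 2 * hm - ha - hb
  have pa := Real.cosh_pos a
  have pb := Real.cosh_pos b
  have pm := Real.cosh_pos ((a + b) / 2)
  rw [← Real.log_mul pa.ne' pb.ne', ← Nat.cast_two (R := ℝ), ← Real.log_pow] at e
  have e' := Real.log_injOn_pos (Set.mem_Ioi.2 (by positivity)) (Set.mem_Ioi.2 (by positivity)) e
  -- `cosh a cosh b = cosh² ((a + b) / 2) + sinh² ((b - a) / 2)`
  have hsinh : Real.sinh ((b - a) / 2) ≠ 0 := by
    rw [Ne, Real.sinh_eq_zero]
    linarith
  have hpos : 0 < Real.sinh ((b - a) / 2) ^ 2 := by positivity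
  have h1 := Real.cosh_sub ((a + b) / 2) ((b - a) / 2)
  have h2 := Real.cosh_add ((a + b) / 2) ((b - a) / 2)
  rw [show (a + b) / 2 - (b - a) / 2 = a by ring] at h1
  rw [show (a + b) / 2 + (b - a) / 2 = b by ring] at h2
  rw [h1, h2] at e'
  have s1 := Real.cosh_sq ((a + b) / 2)
  have s2 := Real.cosh_sq ((b - a) / 2)
  nlinarith

theorem not_chebyshevAffine_flowPotential {a b : ℝ} (hab : a < b) :
    ¬ ChebyshevAffine (n := k + 1) a b (flowPotential k) := by
  intro h
  -- the point with barycentric coordinates `1 / (n + 2), …, 1 / (n + 2), 2 / (n + 2)`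
  set α : Fin (k + 1) → ℝ := fun _ => 1 / ((k : ℝ) + 3) with hα
  have hk : (0 : ℝ) < (k : ℝ) + 3 := by positivity
  have hsum : ∑ i, α i = ((k : ℝ) + 1) / (k + 3) := by
    simp [hα]
    ring
  have hint : α ∈ interior (okounkovBody (k + 1)) :=
    mem_interior_okounkovBody (fun i => by positivity) (by
      rw [hsum, div_lt_one hk]
      linarith)
  obtain ⟨A, B, hAB⟩ := h α hint
  have hC : α 0 - (1 - ∑ i, α i) ≠ 0 := by
    have : α 0 - (1 - ∑ i, α i) = -(1 / ((k : ℝ) + 3)) := by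
      rw [hsum, hα]
      field_simp
      ring
    rw [this]
    exact neg_ne_zero.2 (by positivity)
  refine not_affine_log_cosh hab hC
    (A := A - ∑ j, barycentric α j * Real.log (barycentric α j)) (B := B) fun t ht => ?_
  have := hAB t ht
  rw [chebyshevPotential_flowPotential t hint, chebyshevValue_eq] at this
  linarith

end Chebyshev

/-! ### The curve of `2 × 2` matrices -/

section TwoByTwo

theorem coshCurve_posDef (t : ℝ) : (coshCurve t).PosDef := by
  refine Matrix.PosDef.of_dotProduct_mulVec_pos ?_ fun x hx => ?_
  · ext i j
    fin_cases i <;> fin_cases j <;>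
      simp [coshCurve, -Complex.ofReal_cosh, -Complex.ofReal_sinh]
  · rw [star_dotProduct_coshCurve_mulVec]
    exact_mod_cast norm_flowFrame_sq_pos t hx

theorem tailDet_coshCurve_zero (t : ℝ) : tailDet (n := 1) (coshCurve t) 0 = 1 := by
  let e : {j : Fin (1 + 1) // 0 ≤ (j : ℕ)} ≃ Fin (1 + 1) :=
    Equiv.subtypeUnivEquiv fun _ => Nat.zero_le _
  have h : (coshCurve t).submatrix (Subtype.val : {j : Fin (1 + 1) // 0 ≤ (j : ℕ)} → Fin (1 + 1))
      (Subtype.val : {j : Fin (1 + 1) // 0 ≤ (j : ℕ)} → Fin (1 + 1)) =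
      (coshCurve t).submatrix e e := rfl
  rw [tailDet, h, Matrix.det_submatrix_equiv_self, coshCurve, Matrix.det_fin_two_of]
  norm_cast
  linarith [Real.cosh_sq t]

theorem tailDet_coshCurve_one (t : ℝ) : tailDet (n := 1) (coshCurve t) 1 = Real.cosh t := by
  let _ : Unique {j : Fin (1 + 1) // 1 ≤ (j : ℕ)} :=
    ⟨⟨⟨1, le_rfl⟩⟩, fun j => Subtype.ext <| Fin.ext <|
      le_antisymm (Nat.lt_succ_iff.1 j.1.2) j.2⟩
  rw [tailDet, Matrix.det_unique]
  rfl

theorem tailDet_coshCurve_two (t : ℝ) : tailDet (n := 1) (coshCurve t) 2 = 1 := by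
  have : IsEmpty {j : Fin (1 + 1) // 2 ≤ (j : ℕ)} := ⟨fun j => by have := j.2; omega⟩
  rw [tailDet, Matrix.det_isEmpty]

end TwoByTwo

end ChebyshevFS

end

theorem mainTheorem4 :
    (∀ n : ℕ, 1 ≤ n →
      (∃ φ : ℝ → (Fin (n + 1) → ℂ) → ℝ,
        ChebyshevFS.IsGeodesic 0 1 φ ∧ ChebyshevFS.ChebyshevExists 0 1 φ ∧
          ¬ ChebyshevFS.ChebyshevAffine 0 1 φ) ∧
      ¬ (∀ φ : ℝ → (Fin (n + 1) → ℂ) → ℝ, ChebyshevFS.IsKahlerSegment 0 1 φ →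
          (ChebyshevFS.IsGeodesic 0 1 φ ↔ ChebyshevFS.ChebyshevAffine 0 1 φ))) ∧
    ((∀ t : ℝ, (ChebyshevFS.coshCurve t).PosDef ∧
        ChebyshevFS.mu 0 (ChebyshevFS.coshCurve t) = ((1 / Real.cosh t : ℝ) : ℂ) ∧
        ChebyshevFS.mu 1 (ChebyshevFS.coshCurve t) = (Real.cosh t : ℂ)) ∧
      ∀ a b : ℝ, a < b →
        ChebyshevFS.IsGeodesic a b (fun t => ChebyshevFS.fubiniStudy (ChebyshevFS.coshCurve t)) ∧
        ChebyshevFS.ChebyshevExists a b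
          (fun t => ChebyshevFS.fubiniStudy (ChebyshevFS.coshCurve t)) ∧
        ¬ ChebyshevFS.ChebyshevAffine a b
          (fun t => ChebyshevFS.fubiniStudy (ChebyshevFS.coshCurve t))) := by
  refine ⟨fun n hn => ?_, fun t => ?_, fun a b hab => ?_⟩
  · obtain ⟨k, rfl⟩ := Nat.exists_eq_add_of_le' hn
    have hgeo := ChebyshevFS.isGeodesic_flowPotential (k := k) 0 1
    have hna := ChebyshevFS.not_chebyshevAffine_flowPotential (k := k) zero_lt_one
    exact ⟨⟨_, hgeo, ChebyshevFS.chebyshevExists_flowPotential 0 1, hna⟩,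
      fun h => hna ((h _ hgeo.toIsKahlerSegment).1 hgeo)⟩
  · refine ⟨ChebyshevFS.coshCurve_posDef t, ?_, ?_⟩
    · rw [ChebyshevFS.mu, ChebyshevFS.tailDet_coshCurve_zero, ChebyshevFS.tailDet_coshCurve_one]
      push_cast
      rfl
    · rw [ChebyshevFS.mu, ChebyshevFS.tailDet_coshCurve_one, ChebyshevFS.tailDet_coshCurve_two,
        div_one]
  · have h : (fun t => ChebyshevFS.fubiniStudy (ChebyshevFS.coshCurve t)) =
        ChebyshevFS.flowPotential 0 :=
      funext fun t => (ChebyshevFS.flowPotential_eq_fubiniStudy t).symm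
    rw [h]
    exact ⟨ChebyshevFS.isGeodesic_flowPotential a b,
      ChebyshevFS.chebyshevExists_flowPotential a b,
      ChebyshevFS.not_chebyshevAffine_flowPotential hab⟩
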